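/- **Setting.** Let $(x_i,y_i,s_i)$, $1\le i\le n$, be data points whose sensitive attribute $s_i$ takes $q$ values, let $F_j(x;\theta)$, $1\le j\le m$, be the softmax outputs of a model with parameter $\theta\in\mathbb R^d$, and let $\ell(\theta,x,y)$ be the loss (for instance $\ell(\hat y_\theta(x),y)$). For a list $S$ of indices in $\{1,\dots,n\}$ put $\hat P_j(\theta;S)=\frac1{|S|}\sum_{i\in S}F_j(x_i;\theta)$ and $\hat P_{jk}(\theta;S)=\frac1{|S|}\sum_{i\in S}F_j(x_i;\theta)\mathbf 1(s_i=k)$; write $P_j(\theta),P_{jk}(\theta)$ for these quantities on the whole data set, and $\pi_k=\frac1n\sum_i\mathbf 1(s_i=k)$. Let $f:(0,\infty)\to\mathbb R$ be convex, $f^*(a)=\sup_{t>0}(at-f(t))$, and $\lambda\ge0$. The $f$-FERM problem is to minimize $$\Phi(\theta)=\frac1n\sum_{i=1}^n\ell(\theta,x_i,y_i)+\lambda\sum_{j,k}\pi_kP_j(\theta)\,f\Big(\frac{P_{jk}(\theta)}{P_j(\theta)\pi_k}\Big).$$ **Algorithm (SGDA, batch size $B$, $1\le B\le n$).** Let $I=[a_1,a_2]$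 be a compact interval on which $f^*$ is finite and differentiable (one-sidedly at the end points) with Lipschitz derivative. Start from $\theta^0\in\mathbb R^d$ and $A^0\in I^{m\times q}$. In step $t$ draw a list $S_t$ of $B$ indices independently and uniformly from $\{1,\dots,n\}$ and set $$\theta^{t}=\theta^{t-1}-\eta_\theta\nabla_\theta\Big[\frac1B\sum_{i\in S_t}\ell(\theta,x_i,y_i)+\lambda\sum_{j,k}\big(A^{t-1}_{jk}\hat P_{jk}(\theta;S_t)-\pi_kf^*(A^{t-1}_{jk})\hat P_j(\theta;S_t)\big)\Big]_{\theta=\theta^{t-1}},$$ $$A^{t}_{jk}=\Pi_I\Big(A^{t-1}_{jk}+\eta_\alpha\big(\hat P_{jk}(\theta^{t-1};S_t)-\pi_k(f^*)'(A^{t-1}_{jk})\hat P_j(\theta^{t-1};S_t)\big)\Big),$$ where $\Pi_I$ is the projection onto $I$ (it has no effect as long as the entries of $A$ stay in $I$). **Stationarity.** For $\rho>0$ let $\Phi_{1/(2\rho)}(\theta)=\inf_w\,(\Phi(w)+\rho\|w-\theta\|^2)$ be the Moreau envelope of $\Phi$. A point $\theta$ is $\varepsilon$-stationary if $\Phi_{1/(2\rho)}$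 is differentiable at $\theta$ and $\|\nabla\Phi_{1/(2\rho)}(\theta)\|\le\varepsilon$. **Theorem.** Let $G,\beta,L,b,\tau,\Delta\ge0$, $\mu,\pi_0>0$, and assume that $I$ contains a subgradient of $f$ at every $t>0$ with $\tau/2\le t\le1/\pi_0$. There is $\rho_0>0$ such that for every $\rho\ge\rho_0$ there are $c_1,c_2,C>0$ with the following property, where $\rho_0$ depends only on $m,q,f,I,\lambda,G,\beta,L,b,\pi_0,\mu,\tau,\Delta$, and $c_1,c_2,C$ depend only on these and $\rho$. Consider any dimension $d$, number $n$ of data points, data, model, loss and starting point such that 1. $\ell(\cdot,x_i,y_i)$ is $G$-Lipschitz and differentiable with $\beta$-Lipschitz gradient for all $i$, and $\frac1n\sum_i\ell(\theta^0,x_i,y_i)-\frac1n\sum_i\ell(\theta,x_i,y_i)\le\Delta$ for all $\theta$; 2. $F_j(x_i;\cdot)$ is $L$-Lipschitz and differentiable with $b$-Lipschitz gradient for all $i,j$; 3. $\pi_k\ge\pi_0$ for all $k$. Let $1\le B\le n$, let $\varepsilon>0$, let $T\ge C\varepsilon^{-8}$ be an integer, and run the algorithm with $\eta_\theta=c_1\min(\varepsilon,1)^6$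 and $\eta_\alpha=c_2\min(\varepsilon,1)^2$. If 4. $P_j(\theta^t)\ge\mu/2$ and $\dfrac{P_{jk}(\theta^t)}{P_j(\theta^t)\pi_k}\ge\tau$ for all $j,k$ along all iterates $\theta^t$, $0\le t\le T$, then $\Phi_{1/(2\rho)}$ is differentiable at all these iterates, and $$\frac1{T+1}\sum_{t=0}^{T}\mathbb E\,\big\|\nabla\Phi_{1/(2\rho)}(\theta^t)\big\|\le\varepsilon .$$ That is, SGDA with any batch size from $1$ to $n$ finds an $\varepsilon$-stationary point of $f$-FERM (in expectation, at an iterate drawn uniformly) in $O(\varepsilon^{-8})$ iterations. The condition on the ratios in (4) is void for $\tau=0$; this choice is possible exactly when $f$ has bounded slopes near $0$, as for the $\chi^2$ divergence and the total variation. -/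

import Mathlib

open scoped NNReal BigOperators

namespace FFERM

/-- The parameter space `ℝ^d` with its Euclidean norm. -/
abbrev Param (d : ℕ) : Type := EuclideanSpace ℝ (Fin d)

/-- The data of a fair classification problem: `n` training points `(x i, y i, s i)` whose sensitive
attribute `s i` takes `q` values, a model with parameter `θ ∈ ℝ^d` and `m` logits, and the loss
`loss θ x y`, which stands for `ℓ(ŷ_θ(x), y)`. -/
structure Problem (X Y : Type*) (d m q n : ℕ) where
  x : Fin n → X
  y : Fin n → Y
  s : Fin n → Fin q
  logit : Param d → X → Fin m → ℝ
  loss : Param d → X → Y → ℝ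

/-- `g` is `L`-Lipschitz and `b`-smooth: differentiable with `b`-Lipschitz gradient. -/
def LipschitzSmooth {d : ℕ} (L b : ℝ≥0) (g : Param d → ℝ) : Prop :=
  LipschitzWith L g ∧ Differentiable ℝ g ∧ LipschitzWith b (gradient g)

/-- The Legendre-Fenchel conjugate `f^*(a) = sup_{t > 0} (a t - f t)` of `f : (0, ∞) → ℝ`.
The real supremum is meaningful exactly where `InConjDomain f a` holds. -/
noncomputable def conj (f : ℝ → ℝ) (a : ℝ) : ℝ :=
  ⨆ t : Set.Ioi (0 : ℝ), (a * (t : ℝ) - f t)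

/-- `f^*(a)` is finite. -/
def InConjDomain (f : ℝ → ℝ) (a : ℝ) : Prop :=
  BddAbove (Set.range fun t : Set.Ioi (0 : ℝ) => a * (t : ℝ) - f t)

/-- `a` is a subgradient at `t` of `f : (0, ∞) → ℝ`. -/
def IsSubgradient (f : ℝ → ℝ) (t a : ℝ) : Prop :=
  ∀ u : ℝ, 0 < u → f t + a * (u - t) ≤ f u

/-- The Moreau envelope `Φ_{1/(2ρ)}(θ) = inf_w (Φ w + ρ ‖w - θ‖²)`. -/
noncomputable def moreauEnvelope {d : ℕ} (ρ : ℝ) (Φ : Param d → ℝ) (θ : Param d) : ℝ :=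
  ⨅ w : Param d, (Φ w + ρ * ‖w - θ‖ ^ 2)

namespace Problem

variable {X Y : Type*} {d m q n : ℕ} (p : Problem X Y d m q n)

/-- `F_j(x_i; θ)`: the `j`-th softmax output of the model at the data point `i`. -/
noncomputable def F (j : Fin m) (i : Fin n) (θ : Param d) : ℝ :=
  Real.exp (p.logit θ (p.x i) j) / ∑ l, Real.exp (p.logit θ (p.x i) l)

/-- `π_k = P(s = k)`, the fraction of the training points that belong to the group `k`. -/
noncomputable def groupMass (k : Fin q) : ℝ :=
  (1 / (n : ℝ)) * ∑ i, if p.s i = k then 1 else 0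

section Batch

/- Averages over a list `S` of `B` (not necessarily distinct) indices of data points.
The whole data set is `S = id`. -/
variable {B : ℕ} (S : Fin B → Fin n)

/-- The average loss over `S`. -/
noncomputable def avgLoss (θ : Param d) : ℝ :=
  (1 / (B : ℝ)) * ∑ r, p.loss θ (p.x (S r)) (p.y (S r))

/-- `P̂_ŷ(j; S)`: the probability of predicting the class `j`, estimated on `S`. -/
noncomputable def predProb (j : Fin m) (θ : Param d) : ℝ :=
  (1 / (B : ℝ)) * ∑ r, p.F j (S r) θ

/-- `P̂_{ŷ,s}(j, k; S)`: the probability of predicting `j` on a member of the group `k`,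
estimated on `S`. -/
noncomputable def jointProb (j : Fin m) (k : Fin q) (θ : Param d) : ℝ :=
  (1 / (B : ℝ)) * ∑ r, p.F j (S r) θ * if p.s (S r) = k then 1 else 0

/-- The min-max objective on `S`: average loss plus
`λ ∑_{j,k} (A_{jk} P̂_{ŷ,s}(j,k;S) - π_k f^*(A_{jk}) P̂_ŷ(j;S))`. -/
noncomputable def dualObjective (f : ℝ → ℝ) (lam : ℝ) (A : Fin m → Fin q → ℝ)
    (θ : Param d) : ℝ :=
  p.avgLoss S θ + lam * ∑ j, ∑ k,
    (A j k * p.jointProb S j k θ - p.groupMass k * conj f (A j k) * p.predProb S j θ)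

end Batch

/-- The objective of `f`-FERM: average training loss plus `λ` times the `f`-divergence between
the joint law of prediction and sensitive attribute and the product of its marginals. -/
noncomputable def fermObjective (f : ℝ → ℝ) (lam : ℝ) (θ : Param d) : ℝ :=
  p.avgLoss id θ + lam * ∑ j, ∑ k, p.groupMass k * p.predProb id j θ *
    f (p.jointProb id j k θ / (p.predProb id j θ * p.groupMass k))

/-- One step of stochastic gradient descent-ascent from `(θ, A)` with the minibatch `S`: a
gradient descent step in `θ` and, simultaneously, a gradient ascent step in `A`, projected
entrywise onto the dual interval `[a₁, a₂]`. -/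
noncomputable def step (f : ℝ → ℝ) (a₁ a₂ lam etaTheta etaA : ℝ) {B : ℕ} (S : Fin B → Fin n)
    (z : Param d × (Fin m → Fin q → ℝ)) : Param d × (Fin m → Fin q → ℝ) :=
  (z.1 - etaTheta • gradient (p.dualObjective S f lam z.2) z.1,
   fun j k => max a₁ (min a₂ (z.2 j k + etaA *
     (p.jointProb S j k z.1 -
       p.groupMass k * derivWithin (conj f) (Set.Icc a₁ a₂) (z.2 j k) * p.predProb S j z.1))))

/-- The state `(θ^t, A^t)` after `t` steps from `z₀` with the minibatches `ω 0, …, ω (t - 1)`. -/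
noncomputable def sgda (f : ℝ → ℝ) (a₁ a₂ lam etaTheta etaA : ℝ) {B : ℕ}
    (z₀ : Param d × (Fin m → Fin q → ℝ)) :
    (t : ℕ) → (Fin t → Fin B → Fin n) → Param d × (Fin m → Fin q → ℝ)
  | 0, _ => z₀
  | t + 1, ω => p.step f a₁ a₂ lam etaTheta etaA (ω (Fin.last t))
      (sgda f a₁ a₂ lam etaTheta etaA z₀ t fun i => ω i.castSucc)

end Problem

end FFERM

/-! The proof combines Fenchel duality with the analysis of descent-ascent for nonconvex-concave
problems. Each term `π P f(t)` with `t = P_jk / (P_j π_k)` is at least `a P_jk - π f^*(a) P_j`, with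
equality if `a` is a subgradient of `f` at `t`. Let `Ψ` (`primal`) be the maximum of the min-max
objective over the dual box. Then `Ψ ≤ Φ` everywhere (`dualObjective_le_fermObjective`). Since `t ≤
1/π₀` always holds, `Ψ = Φ` wherever all ratios are at least `τ/2` (`fermObjective_eq_primal`).

As a maximum of uniformly Lipschitz and smooth functions, `Ψ` is Lipschitz and weakly convex, so its
Moreau envelope is differentiable. For large `ρ` the proximal points of points near an iterate stay
in the region where `Ψ = Φ`. Because `Ψ ≤ Φ`, they are proximal points of `Φ` too, and the two
envelopes agree near the iterate (`moreauEnvelope_fermObjective_eventuallyEq`). It remains to study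
`Ψ`.

A step in `θ` lowers the envelope of `Ψ` in expectation by `η_θ/4` times its squared gradient norm,
up to noise of order `η_θ²` and a multiple of `η_θ λ` times the dual gap (`moreauEnvelope_descent`).
The dual gap is summed over blocks of `K` steps. Against the best dual variable at the start of a
block, projected ascent has the regret of online gradient ascent, and the drift of `θ` adds a term
of order `K² η_θ` (`sum_iterate_dualGap_le_block`). With `η_θ ~ ε⁶`, `η_α ~ ε²`, `K ~ ε⁻⁴` and `T ~
ε⁻⁸`, all averaged errors are of order `ε²`.

Minibatches enter only through unbiasedness and uniform bounds, so every batch size works and the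
same batch may serve both updates. -/

namespace FFERM

/-! ### Moreau envelopes of functions with supporting paraboloids -/

section Moreau

variable {d : ℕ} {Ψ Φ : Param d → ℝ} {ρ ℓ : ℝ} {K : ℝ} {θ θ' w w' : Param d}

/-- At every point, `Ψ` is supported from below by a paraboloid of curvature `ℓ`. -/
def HasLowerParaboloids (ℓ : ℝ) (Ψ : Param d → ℝ) : Prop :=
  ∀ θ, ∃ v : Param d, ∀ w, Ψ θ + inner ℝ v (w - θ) - ℓ * ‖w - θ‖ ^ 2 ≤ Ψ w

/-- `w` is a proximal point of `θ`: it minimizes `Ψ + ρ ‖· - θ‖²`. -/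
def IsProx (ρ : ℝ) (Ψ : Param d → ℝ) (θ w : Param d) : Prop :=
  ∀ u, Ψ w + ρ * ‖w - θ‖ ^ 2 ≤ Ψ u + ρ * ‖u - θ‖ ^ 2

/-- Outside the ball of radius `K / ρ` the quadratic term outweighs any decrease that the Lipschitz
bound allows, so a minimizer over this compact ball is global. -/
theorem exists_isProx (hK : 0 ≤ K) (hΨ : ∀ u v, Ψ u - Ψ v ≤ K * ‖u - v‖) (hρ : 0 < ρ)
    (θ : Param d) : ∃ w, IsProx ρ Ψ θ w := by
  have hc : Continuous Ψ := by
    refine (LipschitzWith.of_dist_le_mul (K := K.toNNReal) fun u v => ?_).continuous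
    rw [Real.dist_eq, dist_eq_norm, Real.coe_toNNReal _ hK, abs_le]
    have h1 := hΨ u v
    have h2 := hΨ v u
    rw [norm_sub_rev v u] at h2
    constructor <;> linarith
  obtain ⟨w, -, hw⟩ := (isCompact_closedBall θ (K / ρ)).exists_isMinOn
    ⟨θ, Metric.mem_closedBall_self (div_nonneg hK hρ.le)⟩
    (f := fun u => Ψ u + ρ * ‖u - θ‖ ^ 2) (by fun_prop)
  refine ⟨w, fun u => ?_⟩
  by_cases hu : u ∈ Metric.closedBall θ (K / ρ)
  · exact hw hu
  · have hθ := hw (Metric.mem_closedBall_self (x := θ) (div_nonneg hK hρ.le))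
    simp only [Set.mem_ofPred_eq, sub_self, norm_zero] at hθ
    rw [Metric.mem_closedBall, dist_eq_norm, not_le, div_lt_iff₀ hρ] at hu
    have h1 := hΨ θ u
    rw [norm_sub_rev] at h1
    nlinarith [norm_nonneg (u - θ)]

theorem IsProx.norm_sub_le (hK : 0 ≤ K) (hΨ : ∀ u v, Ψ u - Ψ v ≤ K * ‖u - v‖) (hρ : 0 < ρ)
    (h : IsProx ρ Ψ θ w) : ‖w - θ‖ ≤ K / ρ := by
  have h1 := h θ
  have h2 := hΨ θ w
  simp only [sub_self, norm_zero] at h1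
  rw [norm_sub_rev] at h2
  rw [le_div_iff₀ hρ]
  rcases (norm_nonneg (w - θ)).eq_or_lt with h0 | h0
  · rw [← h0]; simpa using hK
  · nlinarith

theorem IsProx.moreauEnvelope_eq (h : IsProx ρ Ψ θ w) :
    moreauEnvelope ρ Ψ θ = Ψ w + ρ * ‖w - θ‖ ^ 2 :=
  le_antisymm (ciInf_le ⟨_, Set.forall_mem_range.2 h⟩ w) (le_ciInf h)

theorem IsProx.moreauEnvelope_le (h : IsProx ρ Ψ θ w) (u : Param d) :
    moreauEnvelope ρ Ψ θ ≤ Ψ u + ρ * ‖u - θ‖ ^ 2 :=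
  h.moreauEnvelope_eq.trans_le (h u)

/-- This carries proximal points from the primal function to the `f`-FERM objective without any
regularity of the latter. -/
theorem IsProx.of_le (h : IsProx ρ Ψ θ w) (hle : ∀ u, Ψ u ≤ Φ u) (heq : Φ w = Ψ w) :
    IsProx ρ Φ θ w := fun u => by
  rw [heq]; linarith [h u, hle u]

/-- The supporting paraboloid at the midpoint of `u` and `w` bounds the value there by the mean of
the values at `u` and `w`, up to curvature. The parallelogram law gives the matching gain of the
quadratic term, and minimality of `w` is tested at the midpoint. -/
theorem IsProx.growth (hℓ : HasLowerParaboloids ℓ Ψ) (h : IsProx ρ Ψ θ w) (u : Param d) :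
    Ψ w + ρ * ‖w - θ‖ ^ 2 + (ρ - ℓ) / 2 * ‖u - w‖ ^ 2 ≤ Ψ u + ρ * ‖u - θ‖ ^ 2 := by
  set c : Param d := (1 / 2 : ℝ) • (u + w) with hc
  set e : Param d := (1 / 2 : ℝ) • (u - w) with he
  obtain ⟨v, hv⟩ := hℓ c
  have hu : u = c + e := by rw [hc, he]; module
  have hw : w = c - e := by rw [hc, he]; module
  have h1 := hv u
  have h2 := hv w
  have h3 := h c
  have e1 : u - c = e := by rw [hc, he]; module
  have e2 : w - c = -e := by rw [hc, he]; module
  have e3 : ‖u - w‖ ^ 2 = 4 * ‖e‖ ^ 2 := by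
    rw [show u - w = (2 : ℝ) • e by rw [he]; module, norm_smul]; norm_num; ring
  have e4 : ‖u - θ‖ ^ 2 + ‖w - θ‖ ^ 2 = 2 * ‖c - θ‖ ^ 2 + 2 * ‖e‖ ^ 2 := by
    rw [show u - θ = (c - θ) + e by rw [hc, he]; module,
      show w - θ = (c - θ) - e by rw [hc, he]; module]
    nlinarith [parallelogram_law_with_norm ℝ (c - θ) e]
  rw [e1] at h1
  rw [e2, inner_neg_right, norm_neg] at h2
  rw [e3]
  have e5 : ρ * ‖u - θ‖ ^ 2 = 2 * ρ * ‖c - θ‖ ^ 2 + 2 * ρ * ‖e‖ ^ 2 - ρ * ‖w - θ‖ ^ 2 := by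
    linear_combination ρ * e4
  linarith

theorem IsProx.dist_le (hℓ : HasLowerParaboloids ℓ Ψ) (hρ : 0 ≤ ρ) (hρℓ : ℓ < ρ)
    (h : IsProx ρ Ψ θ w) (h' : IsProx ρ Ψ θ' w') :
    ‖w' - w‖ ≤ 2 * ρ / (ρ - ℓ) * ‖θ' - θ‖ := by
  have h1 := h.growth hℓ w'
  have h2 := h'.growth hℓ w
  rw [norm_sub_rev w w'] at h2
  have hid : ‖w' - θ‖ ^ 2 - ‖w - θ‖ ^ 2 + ‖w - θ'‖ ^ 2 - ‖w' - θ'‖ ^ 2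
      = 2 * inner ℝ (w' - w) (θ' - θ) := by
    simp only [← real_inner_self_eq_norm_sq, inner_sub_left, inner_sub_right,
      real_inner_comm θ w, real_inner_comm θ w', real_inner_comm θ' w,
      real_inner_comm θ' w']
    ring
  have h3 := real_inner_le_norm (w' - w) (θ' - θ)
  have h4 : (ρ - ℓ) * ‖w' - w‖ ^ 2 ≤ 2 * ρ * (‖w' - w‖ * ‖θ' - θ‖) := by
    have h5 : ρ * ‖w' - θ‖ ^ 2 - ρ * ‖w - θ‖ ^ 2 + ρ * ‖w - θ'‖ ^ 2 - ρ * ‖w' - θ'‖ ^ 2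
        = 2 * ρ * inner ℝ (w' - w) (θ' - θ) := by linear_combination ρ * hid
    have h6 := mul_le_mul_of_nonneg_left h3 (by positivity : 0 ≤ 2 * ρ)
    linarith
  rw [div_mul_eq_mul_div, le_div_iff₀ (by linarith)]
  rcases (norm_nonneg (w' - w)).eq_or_lt with h0 | h0
  · rw [← h0]
    have := norm_nonneg (θ' - θ)
    simp only [zero_mul]; positivity
  · refine le_of_mul_le_mul_left ?_ h0
    linarith

/-- Testing the envelope at `θ'` with `w`, and the envelope at `θ` with the proximal point `w'` of
`θ'`, bounds the increment from both sides by the same linear term. The errors are quadratic because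
proximal points depend on their centre in a Lipschitz way. -/
theorem IsProx.hasGradientAt (hK : 0 ≤ K) (hΨ : ∀ u v, Ψ u - Ψ v ≤ K * ‖u - v‖)
    (hℓ : HasLowerParaboloids ℓ Ψ) (hρ : 0 < ρ) (hρℓ : ℓ < ρ) (h : IsProx ρ Ψ θ w) :
    HasGradientAt (moreauEnvelope ρ Ψ) ((2 * ρ) • (θ - w)) θ := by
  rw [hasGradientAt_iff_isLittleO]
  refine Asymptotics.IsBigO.trans_isLittleO (g := fun θ' => ‖θ' - θ‖ ^ 2) ?_ ?_
  · refine Asymptotics.IsBigO.of_bound (ρ + 2 * ρ * (2 * ρ / (ρ - ℓ)))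
      (Filter.Eventually.of_forall fun θ' => ?_)
    obtain ⟨w', h'⟩ := exists_isProx hK hΨ hρ θ'
    have hd := h.dist_le hℓ hρ.le hρℓ h'
    have u1 := h'.moreauEnvelope_le w
    have u2 := h.moreauEnvelope_le w'
    rw [h.moreauEnvelope_eq] at u2 ⊢
    rw [h'.moreauEnvelope_eq] at u1 ⊢
    have i1 : ‖w - θ'‖ ^ 2 = ‖w - θ‖ ^ 2 + 2 * inner ℝ (θ - w) (θ' - θ) + ‖θ' - θ‖ ^ 2 := by
      rw [show w - θ' = -((θ - w) + (θ' - θ)) by abel, norm_neg, norm_add_sq_real,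
        norm_sub_rev w θ]
    have i2 : ‖w' - θ‖ ^ 2 = ‖w' - θ'‖ ^ 2 - 2 * inner ℝ (θ - w) (θ' - θ) - ‖θ' - θ‖ ^ 2
        + 2 * inner ℝ (w' - w) (θ' - θ) := by
      have e : inner ℝ (w' - θ) (θ' - θ) = inner ℝ (w' - w) (θ' - θ) - inner ℝ (θ - w) (θ' - θ) := by
        rw [← inner_sub_left]; congr 1; abel
      have e' := norm_sub_sq_real (w' - θ) (θ' - θ)
      rw [sub_sub_sub_cancel_right, e] at e'
      linarith
    have i3 := real_inner_le_norm (w' - w) (θ' - θ)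
    have i4 : ‖w' - w‖ * ‖θ' - θ‖ ≤ 2 * ρ / (ρ - ℓ) * ‖θ' - θ‖ ^ 2 := by
      rw [pow_two, ← mul_assoc]
      exact mul_le_mul_of_nonneg_right hd (norm_nonneg _)
    have i5 : 0 ≤ 2 * ρ / (ρ - ℓ) := div_nonneg (by linarith) (by linarith)
    have i6 : 0 ≤ ρ * (2 * ρ / (ρ - ℓ) * ‖θ' - θ‖ ^ 2) := by positivity
    have i7 := mul_le_mul_of_nonneg_left (i3.trans i4) hρ.le
    rw [i1] at u1
    rw [i2] at u2
    have i8 : 0 ≤ ρ * ‖θ' - θ‖ ^ 2 := by positivity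
    rw [real_inner_smul_left, Real.norm_eq_abs, Real.norm_eq_abs, abs_of_nonneg (by positivity :
      0 ≤ ‖θ' - θ‖ ^ 2), abs_le]
    constructor <;> nlinarith
  · have : (fun θ' : Param d => ‖θ' - θ‖ ^ 2) =o[nhds θ] fun θ' => ‖θ' - θ‖ := by
      have h0 : Filter.Tendsto (fun θ' : Param d => ‖θ' - θ‖) (nhds θ) (nhds 0) := by
        have : Continuous fun θ' : Param d => ‖θ' - θ‖ := by fun_prop
        simpa using this.tendsto θ
      simpa [pow_two] using ((Asymptotics.isLittleO_one_iff ℝ).2 h0).mul_isBigO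
        (Asymptotics.isBigO_refl (fun θ' : Param d => ‖θ' - θ‖) (nhds θ))
    exact this.trans_isBigO (Asymptotics.IsBigO.norm_left (Asymptotics.isBigO_refl _ _))

end Moreau

/-! ### Expectations along a random recursion -/

section Transition

variable {Ω Z : Type*} [Fintype Ω]

/-- The transition operator of the Markov chain `z ↦ step S z` with uniformly distributed `S`. -/
noncomputable def transition (step : Ω → Z → Z) (h : Z → ℝ) (z : Z) : ℝ :=
  𝔼 S, h (step S z)

theorem expect_fin_succ {M : Type*} [AddCommMonoid M] [Module ℚ≥0 M] (t : ℕ)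
    (h : (Fin t → Ω) → Ω → M) :
    𝔼 ω : Fin (t + 1) → Ω, h (fun i => ω i.castSucc) (ω (Fin.last t)) =
      𝔼 ω : Fin t → Ω, 𝔼 S, h ω S := by
  rw [← Finset.expect_product' (s := Finset.univ) (t := Finset.univ) (f := h),
    Finset.univ_product_univ]
  refine Finset.expect_equiv
    ((Fin.snocEquiv fun _ : Fin (t + 1) => Ω).symm.trans (Equiv.prodComm _ _)) (by simp) ?_
  intro ω _
  rfl

/-- The draws are independent, so the last one can be averaged first and absorbed into `h`. Path
expectations thereby become iterates of one operator. -/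
theorem expect_eq_iterate_transition (step : Ω → Z → Z) (z₀ : Z)
    (orbit : (t : ℕ) → (Fin t → Ω) → Z) (h0 : ∀ ω, orbit 0 ω = z₀)
    (hs : ∀ t ω, orbit (t + 1) ω =
      step (ω (Fin.last t)) (orbit t fun i => ω i.castSucc)) (t : ℕ) (h : Z → ℝ) :
    𝔼 ω, h (orbit t ω) = (transition step)^[t] h z₀ := by
  induction t generalizing h with
  | zero => simp [h0]
  | succ t ih =>
    simp only [hs]
    rw [expect_fin_succ t fun ω S => h (step S (orbit t ω)), Function.iterate_succ_apply, ← ih]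
    rfl

variable {step : Ω → Z → Z} {good : Z → Prop} {g h : Z → ℝ}

theorem transition_mono (hgood : ∀ S z, good z → good (step S z)) (hgh : ∀ z, good z → g z ≤ h z)
    {z : Z} (hz : good z) : transition step g z ≤ transition step h z :=
  Finset.expect_le_expect fun S _ => hgh _ (hgood S z hz)

theorem iterate_transition_mono (hgood : ∀ S z, good z → good (step S z))
    (hgh : ∀ z, good z → g z ≤ h z) (t : ℕ) {z : Z} (hz : good z) :
    (transition step)^[t] g z ≤ (transition step)^[t] h z := by
  induction t generalizing g h with
  | zero => exact hgh z hz
  | succ t ih => exact ih fun z hz => transition_mono hgood hgh hz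

theorem iterate_transition_add (t : ℕ) (z : Z) : (transition step)^[t] (fun z => g z + h z) z =
    (transition step)^[t] g z + (transition step)^[t] h z := by
  induction t generalizing g h with
  | zero => rfl
  | succ t ih =>
    simp only [Function.iterate_succ_apply]
    rw [← ih]
    exact congrFun (congrArg _ (funext fun z => Finset.expect_add_distrib _ _ _)) z

theorem iterate_transition_const_mul (c : ℝ) (t : ℕ) (z : Z) :
    (transition step)^[t] (fun z => c * g z) z = c * (transition step)^[t] g z := by
  induction t generalizing g with
  | zero => rfl
  | succ t ih =>
    simp only [Function.iterate_succ_apply]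
    rw [← ih]
    exact congrFun (congrArg _ (funext fun z => (Finset.mul_expect _ _ _).symm)) z

theorem iterate_transition_const [Nonempty Ω] (c : ℝ) (t : ℕ) (z : Z) :
    (transition step)^[t] (fun _ => c) z = c := by
  induction t with
  | zero => rfl
  | succ t ih =>
    rw [Function.iterate_succ_apply]
    convert ih using 2
    funext z
    exact Finset.expect_const Finset.univ_nonempty c

theorem iterate_transition_sum (K t : ℕ) (g : ℕ → Z → ℝ) (z : Z) :
    (transition step)^[t] (fun z => ∑ k ∈ Finset.range K, g k z) z =
      ∑ k ∈ Finset.range K, (transition step)^[t] (g k) z := by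
  induction K with
  | zero =>
    have := iterate_transition_const_mul (step := step) (g := fun _ => 0) 0 t z
    simpa using this
  | succ K ih =>
    simp only [Finset.sum_range_succ]
    rw [iterate_transition_add, ih]

/-- A bound on the sum over a block of `K` steps from an arbitrary good start bounds every sum. -/
theorem sum_iterate_transition_le [Nonempty Ω] (hgood : ∀ S z, good z → good (step S z))
    (hg : ∀ z, good z → 0 ≤ g z) {K : ℕ} (hK : 0 < K) {V : ℝ}
    (hV : ∀ z, good z → ∑ k ∈ Finset.range K, (transition step)^[k] g z ≤ V) (N : ℕ) {z : Z}
    (hz : good z) :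
    ∑ k ∈ Finset.range N, (transition step)^[k] g z ≤ ((N : ℝ) / K + 1) * V := by
  have hnn : ∀ k, 0 ≤ (transition step)^[k] g z := fun k => by
    have := iterate_transition_mono (g := fun _ => 0) hgood hg k hz
    rwa [iterate_transition_const] at this
  have hV0 : 0 ≤ V := (Finset.sum_nonneg fun k _ => hnn k).trans (hV z hz)
  have hblocks : ∀ b : ℕ, ∑ k ∈ Finset.range (b * K), (transition step)^[k] g z ≤ b * V := by
    intro b
    induction b with
    | zero => simp
    | succ b ih =>
      rw [add_mul, one_mul, Finset.sum_range_add]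
      have : ∑ x ∈ Finset.range K, (transition step)^[b * K + x] g z ≤ V := by
        have h1 := iterate_transition_mono (h := fun _ => V) hgood hV (b * K) hz
        rw [iterate_transition_const, iterate_transition_sum] at h1
        simpa only [Function.iterate_add_apply] using h1
      push_cast
      linarith
  -- The last, incomplete block is filled up with nonnegative terms; it accounts for the `+ 1` in
  -- the bound.
  have hNle : N ≤ (N / K + 1) * K := by
    have := Nat.lt_div_mul_add hK (a := N)
    rw [add_mul, one_mul]; omega
  calc _ ≤ ∑ k ∈ Finset.range ((N / K + 1) * K), (transition step)^[k] g z :=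
        Finset.sum_le_sum_of_subset_of_nonneg (by simpa using hNle) fun k _ _ => hnn k
    _ ≤ ((N / K + 1 : ℕ) : ℝ) * V := hblocks _
    _ ≤ _ := by
        refine mul_le_mul_of_nonneg_right ?_ hV0
        push_cast
        linarith [Nat.cast_div_le (α := ℝ) (m := N) (n := K)]

end Transition

/-- The expectation of an average over a uniformly drawn list is the average over the data. -/
theorem expect_average {B n : ℕ} (hB : 1 ≤ B) (u : Fin n → ℝ) :
    𝔼 S : Fin B → Fin n, (1 / (B : ℝ)) * ∑ r, u (S r) = (1 / (n : ℝ)) * ∑ i, u i := by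
  have hB0 : (B : ℝ) ≠ 0 := by positivity
  have key : ∀ r : Fin B, 𝔼 S : Fin B → Fin n, u (S r) = (1 / (n : ℝ)) * ∑ i, u i := fun r => by
    -- Each index occupies position `r` in `n ^ (B - 1)` of the `n ^ B` lists.
    have h := Fintype.sum_piFinset_apply u Finset.univ r
    rw [Fintype.piFinset_univ] at h
    rw [Fintype.expect_eq_sum_div_card, h]
    rcases n.eq_zero_or_pos with rfl | hn
    · simp
    have hn0 : (n : ℝ) ≠ 0 := by positivity
    obtain ⟨B, rfl⟩ := Nat.exists_eq_add_of_le' hB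
    simp only [Finset.card_univ, Fintype.card_fin, Fintype.card_fun, nsmul_eq_mul,
      Nat.add_sub_cancel]
    push_cast
    field_simp
    ring
  rw [← Finset.mul_expect, Finset.expect_sum_comm]
  simp only [key, Finset.sum_const, Finset.card_univ, Fintype.card_fin, nsmul_eq_mul]
  field_simp

end FFERM

namespace FFERM

/-! ### Smooth functions -/

section Smooth

variable {d : ℕ} {g h : Param d → ℝ} {g' h' θ : Param d} {L b : ℝ≥0}

theorem hasGradientAt_add (hg : HasGradientAt g g' θ) (hh : HasGradientAt h h' θ) :
    HasGradientAt (fun θ => g θ + h θ) (g' + h') θ := by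
  rw [hasGradientAt_iff_hasFDerivAt] at *
  rw [map_add]
  exact hg.add hh

theorem hasGradientAt_const_mul (c : ℝ) (hg : HasGradientAt g g' θ) :
    HasGradientAt (fun θ => c * g θ) (c • g') θ := by
  rw [hasGradientAt_iff_hasFDerivAt] at *
  have := hg.const_mul c
  rwa [map_smulₛₗ]

theorem hasGradientAt_sum {ι : Type*} (s : Finset ι) {g : ι → Param d → ℝ} {g' : ι → Param d}
    (hg : ∀ i ∈ s, HasGradientAt (g i) (g' i) θ) :
    HasGradientAt (fun θ => ∑ i ∈ s, g i θ) (∑ i ∈ s, g' i) θ := by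
  simp only [hasGradientAt_iff_hasFDerivAt] at *
  rw [map_sum]
  exact HasFDerivAt.fun_sum hg

theorem LipschitzSmooth.hasGradientAt (hg : LipschitzSmooth L b g) (θ : Param d) :
    HasGradientAt g (gradient g θ) θ := (hg.2.1 θ).hasGradientAt

theorem LipschitzSmooth.norm_gradient_le (hg : LipschitzSmooth L b g) (θ : Param d) :
    ‖gradient g θ‖ ≤ L := by
  rw [gradient, LinearIsometryEquiv.norm_map]
  exact norm_fderiv_le_of_lipschitz ℝ hg.1

theorem LipschitzSmooth.abs_sub_le (hg : LipschitzSmooth L b g) (θ w : Param d) :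
    |g w - g θ| ≤ L * ‖w - θ‖ := by
  simpa [Real.dist_eq, dist_eq_norm] using hg.1.dist_le_mul w θ

/-- On the segment the derivative differs from the one at `θ` by at most `b * ‖w - θ‖`, and the mean
value inequality applies. The sharper constant `b / 2` is not needed. -/
theorem LipschitzSmooth.abs_taylor_le (hg : LipschitzSmooth L b g) (θ w : Param d) :
    |g w - g θ - inner ℝ (gradient g θ) (w - θ)| ≤ b * ‖w - θ‖ ^ 2 := by
  have key := Convex.norm_image_sub_le_of_norm_fderiv_le' (𝕜 := ℝ) (f := g)
    (φ := fderiv ℝ g θ) (C := b * ‖w - θ‖) (s := segment ℝ θ w) (x := θ) (y := w)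
    (fun x _ => hg.2.1 x) (fun x hx => ?_) (convex_segment θ w) (left_mem_segment ℝ θ w)
    (right_mem_segment ℝ θ w)
  · rw [inner_gradient_left, ← Real.norm_eq_abs]
    refine key.trans_eq (by ring)
  · rw [← toDual_gradient, ← toDual_gradient, ← map_sub, LinearIsometryEquiv.norm_map,
      ← dist_eq_norm]
    refine (hg.2.2.dist_le_mul x θ).trans (mul_le_mul_of_nonneg_left ?_ b.2)
    rw [dist_eq_norm]
    exact norm_sub_le_of_mem_segment hx

end Smooth

theorem norm_average_le {E : Type*} [SeminormedAddCommGroup E] [NormedSpace ℝ E] {B : ℕ}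
    {u : Fin B → E} {c : ℝ} (hc : 0 ≤ c) (hu : ∀ r, ‖u r‖ ≤ c) :
    ‖(1 / (B : ℝ)) • ∑ r, u r‖ ≤ c := by
  rw [norm_smul, Real.norm_of_nonneg (by positivity)]
  have h1 : ‖∑ r, u r‖ ≤ B * c := by
    refine (norm_sum_le_of_le Finset.univ fun r _ => hu r).trans_eq (by simp)
  rcases B.eq_zero_or_pos with rfl | hB
  · simpa
  · have : (0 : ℝ) < B := by positivity
    rw [one_div, inv_mul_le_iff₀ this]
    exact h1

theorem norm_double_sum_le {E : Type*} [SeminormedAddCommGroup E] {m q : ℕ}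
    {u : Fin m → Fin q → E} {c : ℝ} (hu : ∀ j k, ‖u j k‖ ≤ c) :
    ‖∑ j, ∑ k, u j k‖ ≤ m * q * c := by
  refine (norm_sum_le_of_le Finset.univ fun j _ => norm_sum_le_of_le Finset.univ
    fun k _ => hu j k).trans_eq ?_
  simp [mul_assoc]

/-! ### The dual interval -/

/-- `f^*` is finite, bounded by `Cs` and convex with slopes bounded by `Cd` on the dual interval
`[a₁, a₂]`, which is contained in `[-Ca, Ca]`. -/
structure DualInterval (f : ℝ → ℝ) (a₁ a₂ Ca Cs Cd : ℝ) : Prop where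
  le : a₁ ≤ a₂
  finite : ∀ a ∈ Set.Icc a₁ a₂, InConjDomain f a
  continuousOn : ContinuousOn (conj f) (Set.Icc a₁ a₂)
  abs_le : ∀ a ∈ Set.Icc a₁ a₂, |a| ≤ Ca
  abs_conj_le : ∀ a ∈ Set.Icc a₁ a₂, |conj f a| ≤ Cs
  abs_deriv_le : ∀ a ∈ Set.Icc a₁ a₂, |derivWithin (conj f) (Set.Icc a₁ a₂) a| ≤ Cd
  subgradient : ∀ a ∈ Set.Icc a₁ a₂, ∀ a' ∈ Set.Icc a₁ a₂,
    conj f a + derivWithin (conj f) (Set.Icc a₁ a₂) a * (a' - a) ≤ conj f a'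

theorem le_conj {f : ℝ → ℝ} {a t : ℝ} (h : InConjDomain f a) (ht : 0 < t) :
    a * t - f t ≤ conj f a := le_ciSup h (⟨t, ht⟩ : Set.Ioi (0 : ℝ))

/-- The equality case of Fenchel's inequality: the subgradient condition says that the supremum is
attained at `t`. -/
theorem IsSubgradient.conj_eq {f : ℝ → ℝ} {a t : ℝ} (h : IsSubgradient f t a) (ht : 0 < t) :
    conj f a = a * t - f t := by
  have hle : ∀ u : Set.Ioi (0 : ℝ), a * (u : ℝ) - f u ≤ a * t - f t := fun u => by
    have := h u u.2
    linarith
  have : Nonempty (Set.Ioi (0 : ℝ)) := ⟨⟨t, ht⟩⟩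
  exact le_antisymm (ciSup_le hle) (le_conj ⟨_, Set.forall_mem_range.2 hle⟩ ht)

theorem convexOn_conj {f : ℝ → ℝ} {I : Set ℝ} (hI : Convex ℝ I)
    (hdom : ∀ a ∈ I, InConjDomain f a) : ConvexOn ℝ I (conj f) := by
  refine ⟨hI, fun a ha a' ha' s t hs ht hst => ?_⟩
  have : Nonempty (Set.Ioi (0 : ℝ)) := ⟨⟨1, Set.mem_Ioi.2 one_pos⟩⟩
  refine ciSup_le fun u => ?_
  have h1 := mul_le_mul_of_nonneg_left (le_conj (hdom a ha) u.2) hs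
  have h2 := mul_le_mul_of_nonneg_left (le_conj (hdom a' ha') u.2) ht
  simp only [smul_eq_mul]
  have h3 : f u = s * f u + t * f u := by rw [← add_mul, hst, one_mul]
  linarith

/-- The bounds come from continuity on a compact interval. The conjugate is convex as a supremum of
affine functions, so its one-sided derivatives are subgradients relative to the interval. -/
theorem exists_dualInterval {f : ℝ → ℝ} {a₁ a₂ : ℝ} (ha : a₁ ≤ a₂)
    (hdom : ∀ a ∈ Set.Icc a₁ a₂, InConjDomain f a)
    (hdiff : DifferentiableOn ℝ (conj f) (Set.Icc a₁ a₂)) {M : ℝ≥0}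
    (hsmooth : LipschitzOnWith M (derivWithin (conj f) (Set.Icc a₁ a₂)) (Set.Icc a₁ a₂)) :
    ∃ Ca Cs Cd, DualInterval f a₁ a₂ Ca Cs Cd := by
  obtain ⟨Ca, hCa⟩ := isCompact_Icc.exists_bound_of_continuousOn
    (continuousOn_id (s := Set.Icc a₁ a₂))
  obtain ⟨Cs, hCs⟩ := isCompact_Icc.exists_bound_of_continuousOn hdiff.continuousOn
  obtain ⟨Cd, hCd⟩ := isCompact_Icc.exists_bound_of_continuousOn hsmooth.continuousOn
  have hconv := convexOn_conj (convex_Icc a₁ a₂) hdom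
  refine ⟨Ca, Cs, Cd, ha, hdom, hdiff.continuousOn, hCa, hCs, hCd, fun a haI a' haI' => ?_⟩
  have hd := (hdiff a haI).hasDerivWithinAt
  rcases lt_trichotomy a a' with h | rfl | h
  · have := hconv.le_slope_of_hasDerivWithinAt haI haI' h hd
    rw [slope_def_field, le_div_iff₀ (by linarith)] at this
    linarith
  · simp
  · have := hconv.slope_le_of_hasDerivWithinAt haI' haI h hd
    rw [slope_def_field, div_le_iff₀ (by linarith)] at this
    linarith

theorem DualInterval.nonneg {f : ℝ → ℝ} {a₁ a₂ Ca Cs Cd : ℝ} (h : DualInterval f a₁ a₂ Ca Cs Cd) :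
    0 ≤ Ca ∧ 0 ≤ Cs ∧ 0 ≤ Cd :=
  have h1 : a₁ ∈ Set.Icc a₁ a₂ := ⟨le_rfl, h.le⟩
  ⟨(abs_nonneg _).trans (h.abs_le _ h1), (abs_nonneg _).trans (h.abs_conj_le _ h1),
    (abs_nonneg _).trans (h.abs_deriv_le _ h1)⟩

/-! ### The min-max objective -/

namespace Problem

variable {X Y : Type*} {d m q n : ℕ} (p : Problem X Y d m q n)

theorem groupMass_nonneg (k : Fin q) : 0 ≤ p.groupMass k := by
  unfold groupMass
  refine mul_nonneg (by positivity) (Finset.sum_nonneg fun i _ => ?_)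
  split_ifs <;> norm_num

theorem groupMass_le_one (k : Fin q) : p.groupMass k ≤ 1 := by
  refine (le_abs_self _).trans ?_
  refine norm_average_le (E := ℝ) zero_le_one fun i => ?_
  split_ifs <;> norm_num

theorem F_pos (j : Fin m) (i : Fin n) (θ : Param d) : 0 < p.F j i θ :=
  div_pos (Real.exp_pos _) (Finset.sum_pos (fun _ _ => Real.exp_pos _) ⟨j, Finset.mem_univ _⟩)

theorem F_le_one (j : Fin m) (i : Fin n) (θ : Param d) : p.F j i θ ≤ 1 := by
  unfold F
  refine div_le_one_of_le₀ ?_ (Finset.sum_nonneg fun _ _ => (Real.exp_pos _).le)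
  exact Finset.single_le_sum (f := fun l => Real.exp (p.logit θ (p.x i) l))
    (fun _ _ => (Real.exp_pos _).le) (Finset.mem_univ j)

section Batch

variable {B : ℕ} (S : Fin B → Fin n)

theorem predProb_nonneg (j : Fin m) (θ : Param d) : 0 ≤ p.predProb S j θ :=
  mul_nonneg (by positivity) (Finset.sum_nonneg fun _ _ => (p.F_pos _ _ _).le)

theorem predProb_le_one (j : Fin m) (θ : Param d) : p.predProb S j θ ≤ 1 := by
  refine (le_abs_self _).trans (norm_average_le (E := ℝ) zero_le_one fun r => ?_)
  rw [Real.norm_of_nonneg (p.F_pos _ _ _).le]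
  exact p.F_le_one _ _ _

theorem jointProb_nonneg (j : Fin m) (k : Fin q) (θ : Param d) : 0 ≤ p.jointProb S j k θ := by
  refine mul_nonneg (by positivity) (Finset.sum_nonneg fun r _ =>
    mul_nonneg (p.F_pos _ _ _).le ?_)
  split_ifs <;> norm_num

theorem jointProb_le_predProb (j : Fin m) (k : Fin q) (θ : Param d) :
    p.jointProb S j k θ ≤ p.predProb S j θ := by
  refine mul_le_mul_of_nonneg_left (Finset.sum_le_sum fun r _ => ?_) (by positivity)
  have := p.F_pos j (S r) θ
  split_ifs <;> simp [this.le]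

/-- The coupling of the dual variable `A` with the predictions: the part of the min-max objective
that is multiplied by `λ`. -/
noncomputable def penalty (f : ℝ → ℝ) (A : Fin m → Fin q → ℝ) (θ : Param d) : ℝ :=
  ∑ j, ∑ k, (A j k * p.jointProb S j k θ - p.groupMass k * conj f (A j k) * p.predProb S j θ)

theorem dualObjective_eq_add (f : ℝ → ℝ) (lam : ℝ) (A : Fin m → Fin q → ℝ) (θ : Param d) :
    p.dualObjective S f lam A θ = p.avgLoss S θ + lam * p.penalty S f A θ := rfl

end Batch

/-- The coefficient of `F_j(x_i; θ)` in the penalty of a single data point. -/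
noncomputable def weight (f : ℝ → ℝ) (A : Fin m → Fin q → ℝ) (i : Fin n) (j : Fin m)
    (k : Fin q) : ℝ :=
  A j k * (if p.s i = k then 1 else 0) - p.groupMass k * conj f (A j k)

/-- The penalty of a single data point. -/
noncomputable def pointPenalty (f : ℝ → ℝ) (A : Fin m → Fin q → ℝ) (i : Fin n)
    (θ : Param d) : ℝ :=
  ∑ j, ∑ k, p.weight f A i j k * p.F j i θ

/-- The min-max objective of a single data point. -/
noncomputable def pointObjective (f : ℝ → ℝ) (lam : ℝ) (A : Fin m → Fin q → ℝ) (i : Fin n)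
    (θ : Param d) : ℝ :=
  p.loss θ (p.x i) (p.y i) + lam * p.pointPenalty f A i θ

/-- The gradient of the min-max objective of a single data point. -/
noncomputable def pointGradient (f : ℝ → ℝ) (lam : ℝ) (A : Fin m → Fin q → ℝ) (i : Fin n)
    (θ : Param d) : Param d :=
  gradient (fun θ => p.loss θ (p.x i) (p.y i)) θ +
    lam • ∑ j, ∑ k, p.weight f A i j k • gradient (p.F j i) θ

/-- For fixed `A` the penalty is linear in the softmax outputs. Hence minibatch estimates are
unbiased, and bounds for one data point pass to every batch. -/
theorem penalty_eq_average {B : ℕ} (S : Fin B → Fin n) (f : ℝ → ℝ) (A : Fin m → Fin q → ℝ)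
    (θ : Param d) :
    p.penalty S f A θ = (1 / (B : ℝ)) * ∑ r, p.pointPenalty f A (S r) θ := by
  unfold penalty pointPenalty
  symm
  rw [Finset.sum_comm, Finset.mul_sum]
  refine Finset.sum_congr rfl fun j _ => ?_
  rw [Finset.sum_comm, Finset.mul_sum]
  refine Finset.sum_congr rfl fun k _ => ?_
  simp only [jointProb, predProb, weight, sub_mul, Finset.sum_sub_distrib, Finset.mul_sum, mul_sub]
  congr 1 <;> refine Finset.sum_congr rfl fun r _ => ?_ <;> ring

theorem dualObjective_eq_average {B : ℕ} (S : Fin B → Fin n) (f : ℝ → ℝ) (lam : ℝ)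
    (A : Fin m → Fin q → ℝ) (θ : Param d) :
    p.dualObjective S f lam A θ = (1 / (B : ℝ)) * ∑ r, p.pointObjective f lam A (S r) θ := by
  rw [dualObjective_eq_add, penalty_eq_average]
  simp only [pointObjective, avgLoss, Finset.sum_add_distrib, ← Finset.mul_sum]
  ring

/-- The losses are `G`-Lipschitz and `β`-smooth, the softmax outputs `L`-Lipschitz and
`b`-smooth. -/
structure IsSmooth (G β L b : ℝ≥0) : Prop where
  loss : ∀ i, LipschitzSmooth G β fun θ => p.loss θ (p.x i) (p.y i)
  softmax : ∀ j i, LipschitzSmooth L b (p.F j i)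

/-- All entries of the dual variable lie in the dual interval. -/
def InBox (a₁ a₂ : ℝ) (A : Fin m → Fin q → ℝ) : Prop := ∀ j k, A j k ∈ Set.Icc a₁ a₂

variable {p} {f : ℝ → ℝ} {a₁ a₂ Ca Cs Cd lam : ℝ} {G β L b : ℝ≥0} {A : Fin m → Fin q → ℝ}

theorem IsSmooth.hasGradientAt_pointObjective (hp : p.IsSmooth G β L b) (i : Fin n)
    (θ : Param d) :
    HasGradientAt (p.pointObjective f lam A i) (p.pointGradient f lam A i θ) θ :=
  hasGradientAt_add ((hp.loss i).hasGradientAt θ) <| hasGradientAt_const_mul lam <|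
    hasGradientAt_sum _ fun j _ => hasGradientAt_sum _ fun _ _ =>
      hasGradientAt_const_mul _ ((hp.softmax j i).hasGradientAt θ)

theorem IsSmooth.hasGradientAt_dualObjective (hp : p.IsSmooth G β L b) {B : ℕ}
    (S : Fin B → Fin n) (θ : Param d) :
    HasGradientAt (p.dualObjective S f lam A)
      ((1 / (B : ℝ)) • ∑ r, p.pointGradient f lam A (S r) θ) θ := by
  rw [show p.dualObjective S f lam A = _ from funext (p.dualObjective_eq_average S f lam A)]
  exact hasGradientAt_const_mul _ (hasGradientAt_sum _ fun r _ =>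
    hp.hasGradientAt_pointObjective (S r) θ)

/-- Gradient steps are unbiased. -/
theorem IsSmooth.expect_inner_gradient (hp : p.IsSmooth G β L b) {B : ℕ} (hB : 1 ≤ B)
    (v θ : Param d) :
    𝔼 S : Fin B → Fin n, inner ℝ v (gradient (p.dualObjective S f lam A) θ) =
      inner ℝ v (gradient (p.dualObjective id f lam A) θ) := by
  simp only [(hp.hasGradientAt_dualObjective _ θ).gradient, real_inner_smul_right, inner_sum]
  exact expect_average hB fun i => inner ℝ v (p.pointGradient f lam A i θ)

theorem abs_weight_le (hf : DualInterval f a₁ a₂ Ca Cs Cd) (hA : InBox a₁ a₂ A) (i : Fin n)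
    (j : Fin m) (k : Fin q) : |p.weight f A i j k| ≤ Ca + Cs := by
  refine (abs_sub _ _).trans (add_le_add ?_ ?_)
  · have := hf.abs_le _ (hA j k)
    split_ifs
    · simpa
    · simpa using hf.nonneg.1
  · rw [abs_mul, abs_of_nonneg (p.groupMass_nonneg k)]
    exact (mul_le_of_le_one_left (abs_nonneg _) (p.groupMass_le_one k)).trans
      (hf.abs_conj_le _ (hA j k))

theorem IsSmooth.norm_gradient_dualObjective_le (hp : p.IsSmooth G β L b) (hlam : 0 ≤ lam)
    (hf : DualInterval f a₁ a₂ Ca Cs Cd) (hA : InBox a₁ a₂ A) {B : ℕ} (S : Fin B → Fin n)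
    (θ : Param d) :
    ‖gradient (p.dualObjective S f lam A) θ‖ ≤ G + lam * (m * q * ((Ca + Cs) * L)) := by
  have hC : 0 ≤ Ca + Cs := add_nonneg hf.nonneg.1 hf.nonneg.2.1
  rw [(hp.hasGradientAt_dualObjective S θ).gradient]
  refine norm_average_le (by positivity) fun r => ?_
  refine (norm_add_le _ _).trans (add_le_add ((hp.loss _).norm_gradient_le θ) ?_)
  rw [norm_smul, Real.norm_of_nonneg hlam]
  refine mul_le_mul_of_nonneg_left (norm_double_sum_le fun j k => ?_) hlam
  rw [norm_smul]
  exact mul_le_mul (abs_weight_le hf hA _ j k) ((hp.softmax j _).norm_gradient_le θ)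
    (norm_nonneg _) hC

theorem IsSmooth.abs_penalty_sub_le (hp : p.IsSmooth G β L b)
    (hf : DualInterval f a₁ a₂ Ca Cs Cd) (hA : InBox a₁ a₂ A) {B : ℕ} (S : Fin B → Fin n)
    (θ w : Param d) :
    |p.penalty S f A w - p.penalty S f A θ| ≤ m * q * ((Ca + Cs) * L) * ‖w - θ‖ := by
  have hC : 0 ≤ Ca + Cs := add_nonneg hf.nonneg.1 hf.nonneg.2.1
  rw [penalty_eq_average, penalty_eq_average, ← mul_sub, ← Finset.sum_sub_distrib]
  refine norm_average_le (E := ℝ) (by positivity) fun r => ?_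
  simp only [pointPenalty, ← Finset.sum_sub_distrib, ← mul_sub]
  rw [mul_assoc]
  refine norm_double_sum_le fun j k => ?_
  rw [norm_mul, mul_assoc]
  exact mul_le_mul (abs_weight_le hf hA _ j k) ((hp.softmax j _).abs_sub_le θ w)
    (norm_nonneg _) hC

theorem IsSmooth.abs_avgLoss_sub_le (hp : p.IsSmooth G β L b) {B : ℕ} (S : Fin B → Fin n)
    (θ w : Param d) : |p.avgLoss S w - p.avgLoss S θ| ≤ G * ‖w - θ‖ := by
  rw [avgLoss, avgLoss, ← mul_sub, ← Finset.sum_sub_distrib]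
  exact norm_average_le (E := ℝ) (by positivity) fun r => (hp.loss (S r)).abs_sub_le θ w

theorem IsSmooth.abs_predProb_sub_le (hp : p.IsSmooth G β L b) {B : ℕ} (S : Fin B → Fin n)
    (j : Fin m) (θ w : Param d) : |p.predProb S j w - p.predProb S j θ| ≤ L * ‖w - θ‖ := by
  rw [predProb, predProb, ← mul_sub, ← Finset.sum_sub_distrib]
  exact norm_average_le (E := ℝ) (by positivity) fun r => (hp.softmax j (S r)).abs_sub_le θ w

theorem IsSmooth.abs_jointProb_sub_le (hp : p.IsSmooth G β L b) {B : ℕ} (S : Fin B → Fin n)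
    (j : Fin m) (k : Fin q) (θ w : Param d) :
    |p.jointProb S j k w - p.jointProb S j k θ| ≤ L * ‖w - θ‖ := by
  rw [jointProb, jointProb, ← mul_sub, ← Finset.sum_sub_distrib]
  refine norm_average_le (E := ℝ) (by positivity) fun r => ?_
  rw [← sub_mul, norm_mul]
  refine (mul_le_of_le_one_right (norm_nonneg _) ?_).trans ((hp.softmax j (S r)).abs_sub_le θ w)
  split_ifs <;> simp

theorem IsSmooth.abs_dualObjective_sub_le (hp : p.IsSmooth G β L b) (hlam : 0 ≤ lam)
    (hf : DualInterval f a₁ a₂ Ca Cs Cd) (hA : InBox a₁ a₂ A) {B : ℕ} (S : Fin B → Fin n)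
    (θ w : Param d) :
    |p.dualObjective S f lam A w - p.dualObjective S f lam A θ| ≤
      (G + lam * (m * q * ((Ca + Cs) * L))) * ‖w - θ‖ := by
  rw [dualObjective_eq_add, dualObjective_eq_add, add_sub_add_comm, ← mul_sub, add_mul, mul_assoc]
  refine (abs_add_le _ _).trans (add_le_add (hp.abs_avgLoss_sub_le S θ w) ?_)
  rw [abs_mul, abs_of_nonneg hlam]
  exact mul_le_mul_of_nonneg_left (hp.abs_penalty_sub_le hf hA S θ w) hlam

theorem IsSmooth.abs_taylor_dualObjective_le (hp : p.IsSmooth G β L b) (hlam : 0 ≤ lam)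
    (hf : DualInterval f a₁ a₂ Ca Cs Cd) (hA : InBox a₁ a₂ A) {B : ℕ} (S : Fin B → Fin n)
    (θ w : Param d) :
    |p.dualObjective S f lam A w - p.dualObjective S f lam A θ -
        inner ℝ (gradient (p.dualObjective S f lam A) θ) (w - θ)| ≤
      (β + lam * (m * q * ((Ca + Cs) * b))) * ‖w - θ‖ ^ 2 := by
  have hC : 0 ≤ Ca + Cs := add_nonneg hf.nonneg.1 hf.nonneg.2.1
  rw [(hp.hasGradientAt_dualObjective S θ).gradient, dualObjective_eq_average,
    dualObjective_eq_average, real_inner_smul_left, sum_inner, ← mul_sub, ← mul_sub,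
    ← Finset.sum_sub_distrib, ← Finset.sum_sub_distrib]
  refine norm_average_le (E := ℝ) (by positivity) fun r => ?_
  have e : p.pointObjective f lam A (S r) w - p.pointObjective f lam A (S r) θ -
      inner ℝ (p.pointGradient f lam A (S r) θ) (w - θ) =
      (p.loss w (p.x (S r)) (p.y (S r)) - p.loss θ (p.x (S r)) (p.y (S r)) -
        inner ℝ (gradient (fun θ => p.loss θ (p.x (S r)) (p.y (S r))) θ) (w - θ)) +
      lam * ∑ j, ∑ k, p.weight f A (S r) j k * (p.F j (S r) w - p.F j (S r) θ -
        inner ℝ (gradient (p.F j (S r)) θ) (w - θ)) := by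
    simp only [pointObjective, pointGradient, pointPenalty, inner_add_left, sum_inner,
      real_inner_smul_left, mul_sub, Finset.sum_sub_distrib]
    ring
  rw [e, add_mul]
  refine (norm_add_le _ _).trans (add_le_add ((hp.loss _).abs_taylor_le θ w) ?_)
  rw [norm_mul, Real.norm_of_nonneg hlam, mul_assoc, mul_assoc]
  refine mul_le_mul_of_nonneg_left (norm_double_sum_le fun j k => ?_) hlam
  rw [norm_mul, mul_assoc]
  exact mul_le_mul (abs_weight_le hf hA _ j k) ((hp.softmax j _).abs_taylor_le θ w)
    (norm_nonneg _) hC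

end Problem

end FFERM

namespace FFERM

/-- Projection onto an interval does not increase the distance to its points, so the ascent estimate
survives the clipping. -/
theorem sq_clip_sub_le {a₁ a₂ a x : ℝ} (ha : a ∈ Set.Icc a₁ a₂) :
    (max a₁ (min a₂ x) - a) ^ 2 ≤ (x - a) ^ 2 := by
  obtain ⟨h1, h2⟩ := ha
  rw [sq_le_sq]
  rcases le_total a₂ x with h | h
  · rw [min_eq_left h, max_eq_right (h1.trans h2), abs_of_nonneg (by linarith),
      abs_of_nonneg (by linarith)]
    linarith
  · rw [min_eq_right h]
    rcases le_total a₁ x with h' | h'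
    · rw [max_eq_right h']
    · rw [max_eq_left h', abs_of_nonpos (by linarith), abs_of_nonpos (by linarith)]
      linarith

namespace Problem

variable {X Y : Type*} {d m q n : ℕ} (p : Problem X Y d m q n)

/-! ### The primal function -/

/-- A maximizer of the min-max objective over the dual box. -/
noncomputable def bestDual (f : ℝ → ℝ) (a₁ a₂ : ℝ) (θ : Param d) : Fin m → Fin q → ℝ :=
  Classical.epsilon fun A => InBox a₁ a₂ A ∧
    ∀ A', InBox a₁ a₂ A' → p.penalty id f A' θ ≤ p.penalty id f A θ

/-- The primal function `max_A` of the min-max objective over the dual box. -/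
noncomputable def primal (f : ℝ → ℝ) (a₁ a₂ lam : ℝ) (θ : Param d) : ℝ :=
  p.dualObjective id f lam (p.bestDual f a₁ a₂ θ) θ

/-- The suboptimality of the dual variable in the maximization of the penalty. -/
noncomputable def dualGap (f : ℝ → ℝ) (a₁ a₂ : ℝ) (z : Param d × (Fin m → Fin q → ℝ)) : ℝ :=
  p.penalty id f (p.bestDual f a₁ a₂ z.1) z.1 - p.penalty id f z.2 z.1

variable {p} {f : ℝ → ℝ} {a₁ a₂ Ca Cs Cd lam : ℝ} {G β L b : ℝ≥0}
  {A A' : Fin m → Fin q → ℝ} {θ w : Param d}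

theorem bestDual_spec (hf : DualInterval f a₁ a₂ Ca Cs Cd) (θ : Param d) :
    InBox a₁ a₂ (p.bestDual f a₁ a₂ θ) ∧ ∀ A', InBox a₁ a₂ A' →
      p.penalty id f A' θ ≤ p.penalty id f (p.bestDual f a₁ a₂ θ) θ := by
  refine Classical.epsilon_spec (p := fun A => InBox a₁ a₂ A ∧
    ∀ A', InBox a₁ a₂ A' → p.penalty id f A' θ ≤ p.penalty id f A θ) ?_
  have hbox : {A : Fin m → Fin q → ℝ | InBox a₁ a₂ A} =
      Set.univ.pi fun _ => Set.univ.pi fun _ => Set.Icc a₁ a₂ := by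
    ext A; simp only [InBox, Set.mem_pi, Set.mem_univ, true_implies]; rfl
  have hcomp : IsCompact {A : Fin m → Fin q → ℝ | InBox a₁ a₂ A} := by
    rw [hbox]
    exact isCompact_univ_pi fun _ => isCompact_univ_pi fun _ => isCompact_Icc
  obtain ⟨A, hA, hmax⟩ := hcomp.exists_isMaxOn (f := fun A => p.penalty id f A θ)
    ⟨fun _ _ => a₁, fun _ _ => ⟨le_rfl, hf.le⟩⟩ (by
      refine continuousOn_finsetSum _ fun j _ => continuousOn_finsetSum _ fun k _ => ?_
      have hproj : Continuous fun A : Fin m → Fin q → ℝ => A j k := by fun_prop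
      have hconj : ContinuousOn (fun A : Fin m → Fin q → ℝ => conj f (A j k))
          {A | InBox a₁ a₂ A} :=
        hf.continuousOn.comp hproj.continuousOn fun A hA => hA j k
      exact (hproj.continuousOn.mul continuousOn_const).sub
        ((continuousOn_const.mul hconj).mul continuousOn_const))
  exact ⟨A, hA, fun A' hA' => hmax hA'⟩

theorem dualGap_nonneg (hf : DualInterval f a₁ a₂ Ca Cs Cd)
    {z : Param d × (Fin m → Fin q → ℝ)} (hz : InBox a₁ a₂ z.2) : 0 ≤ p.dualGap f a₁ a₂ z :=
  sub_nonneg.2 ((bestDual_spec hf _).2 _ hz)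

theorem dualObjective_le_primal (hlam : 0 ≤ lam) (hf : DualInterval f a₁ a₂ Ca Cs Cd)
    (hA : InBox a₁ a₂ A) (θ : Param d) :
    p.dualObjective id f lam A θ ≤ p.primal f a₁ a₂ lam θ := by
  rw [primal, dualObjective_eq_add, dualObjective_eq_add]
  gcongr
  exact (bestDual_spec hf θ).2 A hA

theorem IsSmooth.primal_sub_le (hp : p.IsSmooth G β L b) (hlam : 0 ≤ lam)
    (hf : DualInterval f a₁ a₂ Ca Cs Cd) (θ w : Param d) :
    p.primal f a₁ a₂ lam θ - p.primal f a₁ a₂ lam w ≤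
      (G + lam * (m * q * ((Ca + Cs) * L))) * ‖θ - w‖ := by
  have hA := (bestDual_spec (p := p) hf θ).1
  have h1 := dualObjective_le_primal (p := p) hlam hf hA w
  have h2 := (le_abs_self _).trans (hp.abs_dualObjective_sub_le hlam hf hA id w θ)
  rw [← primal] at h2
  linarith

/-- The min-max objective with the dual variable frozen at the maximizer for `θ` touches the primal
function at `θ`, lies below it elsewhere, and has a quadratic Taylor error. -/
theorem IsSmooth.hasLowerParaboloids_primal (hp : p.IsSmooth G β L b) (hlam : 0 ≤ lam)
    (hf : DualInterval f a₁ a₂ Ca Cs Cd) :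
    HasLowerParaboloids (β + lam * (m * q * ((Ca + Cs) * b))) (p.primal f a₁ a₂ lam) := by
  intro θ
  have hA := (bestDual_spec (p := p) hf θ).1
  refine ⟨gradient (p.dualObjective id f lam (p.bestDual f a₁ a₂ θ)) θ, fun w => ?_⟩
  have h1 := dualObjective_le_primal (p := p) hlam hf hA w
  have h2 := (abs_le.1 (hp.abs_taylor_dualObjective_le hlam hf hA id θ w)).1
  rw [← primal] at h2
  linarith

theorem abs_penalty_le (hf : DualInterval f a₁ a₂ Ca Cs Cd) (hA : InBox a₁ a₂ A) {B : ℕ}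
    (S : Fin B → Fin n) (θ : Param d) : |p.penalty S f A θ| ≤ m * q * (Ca + Cs) := by
  have hC : 0 ≤ Ca + Cs := add_nonneg hf.nonneg.1 hf.nonneg.2.1
  rw [penalty_eq_average]
  refine norm_average_le (E := ℝ) (by positivity) fun r => norm_double_sum_le fun j k => ?_
  rw [norm_mul, Real.norm_of_nonneg (p.F_pos _ _ _).le]
  exact (mul_le_of_le_one_right (abs_nonneg _) (p.F_le_one _ _ _)).trans (abs_weight_le hf hA _ _ _)

theorem primal_sub_le_of_avgLoss (hlam : 0 ≤ lam) (hf : DualInterval f a₁ a₂ Ca Cs Cd) {Δ : ℝ}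
    (h : p.avgLoss id θ - p.avgLoss id w ≤ Δ) :
    p.primal f a₁ a₂ lam θ - p.primal f a₁ a₂ lam w ≤ Δ + lam * (2 * (m * q * (Ca + Cs))) := by
  rw [primal, primal, dualObjective_eq_add, dualObjective_eq_add, add_sub_add_comm, ← mul_sub]
  refine add_le_add h (mul_le_mul_of_nonneg_left ?_ hlam)
  have h1 := (abs_le.1 (abs_penalty_le (p := p) hf (bestDual_spec (p := p) hf θ).1 id θ)).2
  have h2 := (abs_le.1 (abs_penalty_le (p := p) hf (bestDual_spec (p := p) hf w).1 id w)).1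
  linarith

/-! ### The primal function and the objective of `f`-FERM -/

theorem predProb_id_pos (hn : 0 < n) (j : Fin m) (θ : Param d) : 0 < p.predProb id j θ := by
  have : (0 : ℝ) < n := by positivity
  exact mul_pos (by positivity) (Finset.sum_pos (fun i _ => p.F_pos _ _ _) ⟨⟨0, hn⟩, by simp⟩)

theorem jointProb_id_pos {k : Fin q} (hk : 0 < p.groupMass k) (j : Fin m) (θ : Param d) :
    0 < p.jointProb id j k θ := by
  have hnn : ∀ i ∈ Finset.univ, 0 ≤ (if p.s i = k then (1 : ℝ) else 0) := fun i _ => by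
    split_ifs <;> norm_num
  have h1 : 0 < ∑ i, if p.s i = k then (1 : ℝ) else 0 :=
    pos_of_mul_pos_right hk (by positivity)
  have h2 : 0 < 1 / (n : ℝ) := pos_of_mul_pos_left hk h1.le
  obtain ⟨i, -, hi⟩ := Finset.exists_ne_zero_of_sum_ne_zero h1.ne'
  refine mul_pos h2 (Finset.sum_pos' (fun i hi => mul_nonneg (p.F_pos _ _ _).le (hnn i hi))
    ⟨i, Finset.mem_univ _, mul_pos (p.F_pos _ _ _) ((hnn i (Finset.mem_univ _)).lt_of_ne' hi)⟩)

theorem dualObjective_le_fermObjective (hlam : 0 ≤ lam) (hn : 0 < n)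
    (hπ : ∀ k, 0 < p.groupMass k) (hf : DualInterval f a₁ a₂ Ca Cs Cd) (hA : InBox a₁ a₂ A)
    (θ : Param d) : p.dualObjective id f lam A θ ≤ p.fermObjective f lam θ := by
  refine add_le_add le_rfl (mul_le_mul_of_nonneg_left
    (Finset.sum_le_sum fun j _ => Finset.sum_le_sum fun k _ => ?_) hlam)
  have hP := p.predProb_id_pos hn j θ
  have hJ := p.jointProb_id_pos (hπ k) j θ
  have hπP := mul_pos hP (hπ k)
  have h := mul_le_mul_of_nonneg_left
    (le_conj (hf.finite _ (hA j k)) (div_pos hJ hπP)) hπP.le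
  have e : p.predProb id j θ * p.groupMass k * (A j k *
      (p.jointProb id j k θ / (p.predProb id j θ * p.groupMass k))) =
      A j k * p.jointProb id j k θ := by
    rw [mul_left_comm, mul_div_cancel₀ _ hπP.ne']
  rw [mul_sub, e] at h
  linarith

/-- Joint probabilities are at most class probabilities and group masses are at least `pi₀`, so
every ratio is at most `1 / pi₀`. The dual interval then contains a subgradient at each ratio, and
these subgradients form `A`. -/
theorem exists_dualObjective_eq_fermObjective (hn : 0 < n) {pi₀ τ : ℝ} (hpi₀ : 0 < pi₀)
    (hπ : ∀ k, pi₀ ≤ p.groupMass k)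
    (hsub : ∀ t : ℝ, 0 < t → τ ≤ t → t ≤ 1 / pi₀ → ∃ a ∈ Set.Icc a₁ a₂, IsSubgradient f t a)
    (hτ : ∀ j k, τ ≤ p.jointProb id j k θ / (p.predProb id j θ * p.groupMass k)) :
    ∃ A, InBox a₁ a₂ A ∧ p.dualObjective id f lam A θ = p.fermObjective f lam θ := by
  have key : ∀ j k, ∃ a ∈ Set.Icc a₁ a₂,
      a * p.jointProb id j k θ - p.groupMass k * conj f a * p.predProb id j θ =
      p.groupMass k * p.predProb id j θ *
        f (p.jointProb id j k θ / (p.predProb id j θ * p.groupMass k)) := fun j k => by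
    have hπk := hpi₀.trans_le (hπ k)
    have hP := p.predProb_id_pos hn j θ
    have hJ := p.jointProb_id_pos hπk j θ
    have ht := div_pos hJ (mul_pos hP hπk)
    obtain ⟨a, ha, hsa⟩ := hsub _ ht (hτ j k) (by
      rw [div_le_div_iff₀ (mul_pos hP hπk) hpi₀, one_mul]
      exact mul_le_mul (p.jointProb_le_predProb id j k θ) (hπ k) hpi₀.le hP.le)
    refine ⟨a, ha, ?_⟩
    rw [hsa.conj_eq ht]
    field_simp
    ring
  choose A hA hA' using key
  refine ⟨A, hA, ?_⟩
  simp only [dualObjective, fermObjective, hA']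

theorem fermObjective_eq_primal (hlam : 0 ≤ lam) (hn : 0 < n) {pi₀ τ : ℝ} (hpi₀ : 0 < pi₀)
    (hπ : ∀ k, pi₀ ≤ p.groupMass k) (hf : DualInterval f a₁ a₂ Ca Cs Cd)
    (hsub : ∀ t : ℝ, 0 < t → τ ≤ t → t ≤ 1 / pi₀ → ∃ a ∈ Set.Icc a₁ a₂, IsSubgradient f t a)
    (hτ : ∀ j k, τ ≤ p.jointProb id j k θ / (p.predProb id j θ * p.groupMass k)) :
    p.fermObjective f lam θ = p.primal f a₁ a₂ lam θ := by
  obtain ⟨A, hA, hA'⟩ :=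
    exists_dualObjective_eq_fermObjective (lam := lam) hn hpi₀ hπ hsub hτ
  exact le_antisymm (hA' ▸ dualObjective_le_primal hlam hf hA θ)
    (dualObjective_le_fermObjective hlam hn (fun k => hpi₀.trans_le (hπ k)) hf
      (bestDual_spec hf θ).1 θ)

/-- The lower bounds on the ratios deteriorate by at most a factor `2` in a small ball. -/
theorem IsSmooth.half_le_ratio (hp : p.IsSmooth G β L b) (hn : 0 < n) {pi₀ τ μ r : ℝ}
    (hpi₀ : 0 < pi₀) (hτ : 0 ≤ τ) (hr : τ = 0 ∨ L * r * (1 + τ / 2) ≤ τ * pi₀ * μ / 4)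
    (hw : ‖w - θ‖ ≤ r) {k : Fin q} (hπ : pi₀ ≤ p.groupMass k) {j : Fin m}
    (hμ : μ / 2 ≤ p.predProb id j θ)
    (hθ : τ ≤ p.jointProb id j k θ / (p.predProb id j θ * p.groupMass k)) :
    τ / 2 ≤ p.jointProb id j k w / (p.predProb id j w * p.groupMass k) := by
  have hπk := hpi₀.trans_le hπ
  have hP := p.predProb_id_pos hn j θ
  have hPw := p.predProb_id_pos hn j w
  rcases hr with rfl | hr
  · have := div_pos (p.jointProb_id_pos hπk j w) (mul_pos hPw hπk)
    simpa using this.le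
  -- The move to `w` costs at most `L * r` in the numerator and `τ / 2 * (L * r)` on the side of the
  -- denominator. Half of `τ * π_k * P_j(θ)`, which is at least `τ * pi₀ * μ / 4`, pays for both.
  rw [le_div_iff₀ (mul_pos hP hπk)] at hθ
  rw [le_div_iff₀ (mul_pos hPw hπk)]
  have hLr : L * ‖w - θ‖ ≤ L * r := mul_le_mul_of_nonneg_left hw L.2
  have h1 := (abs_le.1 (hp.abs_predProb_sub_le id j θ w)).2
  have h2 := (abs_le.1 (hp.abs_jointProb_sub_le id j k θ w)).1
  have hLr0 : 0 ≤ L * r := (mul_nonneg L.2 (norm_nonneg _)).trans hLr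
  have h3 : τ / 2 * (p.predProb id j w * p.groupMass k) ≤
      τ / 2 * ((p.predProb id j θ + L * r) * p.groupMass k) :=
    mul_le_mul_of_nonneg_left (mul_le_mul_of_nonneg_right (by linarith) hπk.le) (by linarith)
  have h4 : τ / 2 * (L * r) * p.groupMass k ≤ τ / 2 * (L * r) :=
    mul_le_of_le_one_right (by positivity) (p.groupMass_le_one k)
  have h5 : τ * (pi₀ * (μ / 2)) ≤ τ * (p.groupMass k * p.predProb id j θ) := by
    refine mul_le_mul_of_nonneg_left ?_ hτ
    exact (mul_le_mul_of_nonneg_left hμ hpi₀.le).trans (mul_le_mul_of_nonneg_right hπ hP.le)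
  nlinarith

/-! ### Regret of the dual variable -/

/-- The moving maximizer is replaced by the one at `θ₀`, at the price of two uses of the Lipschitz
bound in `θ`, which is uniform over the box. No stability of maximizers is needed; without strong
concavity it can fail. -/
theorem IsSmooth.dualGap_le (hp : p.IsSmooth G β L b) (hf : DualInterval f a₁ a₂ Ca Cs Cd)
    (θ₀ θ : Param d) (A : Fin m → Fin q → ℝ) :
    p.dualGap f a₁ a₂ (θ, A) ≤
      p.penalty id f (p.bestDual f a₁ a₂ θ₀) θ - p.penalty id f A θ +
        2 * (m * q * ((Ca + Cs) * L)) * ‖θ - θ₀‖ := by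
  have h1 := (abs_le.1 (hp.abs_penalty_sub_le hf (bestDual_spec (p := p) hf θ).1 id θ₀ θ)).2
  have h2 := (bestDual_spec (p := p) hf θ₀).2 _ (bestDual_spec (p := p) hf θ).1
  have h3 := (abs_le.1 (hp.abs_penalty_sub_le hf (bestDual_spec (p := p) hf θ₀).1 id θ₀ θ)).1
  simp only [dualGap]
  linarith

/-- The squared Euclidean distance of two dual variables. -/
def distSq (A A' : Fin m → Fin q → ℝ) : ℝ := ∑ j, ∑ k, (A j k - A' j k) ^ 2

theorem distSq_nonneg (A A' : Fin m → Fin q → ℝ) : 0 ≤ distSq A A' :=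
  Finset.sum_nonneg fun _ _ => Finset.sum_nonneg fun _ _ => sq_nonneg _

theorem distSq_le (hA : InBox a₁ a₂ A) (hA' : InBox a₁ a₂ A') :
    distSq A A' ≤ m * q * (a₂ - a₁) ^ 2 := by
  refine (le_abs_self _).trans (norm_double_sum_le (E := ℝ) fun j k => ?_)
  obtain ⟨h1, h2⟩ := hA j k
  obtain ⟨h3, h4⟩ := hA' j k
  rw [Real.norm_of_nonneg (sq_nonneg _), sq_le_sq, abs_of_nonneg (by linarith : 0 ≤ a₂ - a₁),
    abs_le]
  constructor <;> linarith

theorem inBox_step (ha : a₁ ≤ a₂) (etaTheta etaA : ℝ) {B : ℕ} (S : Fin B → Fin n)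
    (z : Param d × (Fin m → Fin q → ℝ)) :
    InBox a₁ a₂ (p.step f a₁ a₂ lam etaTheta etaA S z).2 := fun _ _ =>
  ⟨le_max_left _ _, max_le ha (min_le_left _ _)⟩

theorem expect_predProb {B : ℕ} (hB : 1 ≤ B) (j : Fin m) (θ : Param d) :
    𝔼 S : Fin B → Fin n, p.predProb S j θ = p.predProb id j θ :=
  expect_average hB fun i => p.F j i θ

theorem expect_jointProb {B : ℕ} (hB : 1 ≤ B) (j : Fin m) (k : Fin q) (θ : Param d) :
    𝔼 S : Fin B → Fin n, p.jointProb S j k θ = p.jointProb id j k θ :=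
  expect_average hB fun i => p.F j i θ * if p.s i = k then 1 else 0

/-- One step of projected stochastic gradient ascent in the dual variable. -/
theorem expect_distSq_step_le (hn : 0 < n) (hf : DualInterval f a₁ a₂ Ca Cs Cd) {B : ℕ}
    (hB : 1 ≤ B) (etaTheta : ℝ) {etaA : ℝ} (heta : 0 ≤ etaA)
    {z : Param d × (Fin m → Fin q → ℝ)} (hz : InBox a₁ a₂ z.2) (hA : InBox a₁ a₂ A) :
    𝔼 S : Fin B → Fin n, distSq (p.step f a₁ a₂ lam etaTheta etaA S z).2 A ≤
      distSq z.2 A - 2 * etaA * (p.penalty id f A z.1 - p.penalty id f z.2 z.1) +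
        etaA ^ 2 * (m * q * (1 + Cd) ^ 2) := by
  obtain ⟨θ, A₁⟩ := z
  have : Nonempty (Fin n) := ⟨⟨0, hn⟩⟩
  simp only at hz ⊢
  let δ : Fin m → Fin q → ℝ := fun j k => derivWithin (conj f) (Set.Icc a₁ a₂) (A₁ j k)
  have hterm : ∀ j k, 𝔼 S : Fin B → Fin n,
      ((p.step f a₁ a₂ lam etaTheta etaA S (θ, A₁)).2 j k - A j k) ^ 2 ≤
      (A₁ j k - A j k) ^ 2 - 2 * etaA *
        ((A j k * p.jointProb id j k θ - p.groupMass k * conj f (A j k) * p.predProb id j θ) -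
        (A₁ j k * p.jointProb id j k θ - p.groupMass k * conj f (A₁ j k) * p.predProb id j θ)) +
        etaA ^ 2 * (1 + Cd) ^ 2 := fun j k => by
    have hS : ∀ S : Fin B → Fin n,
        ((p.step f a₁ a₂ lam etaTheta etaA S (θ, A₁)).2 j k - A j k) ^ 2 ≤
        (A₁ j k - A j k) ^ 2 + 2 * etaA * (A₁ j k - A j k) * p.jointProb S j k θ -
          2 * etaA * (A₁ j k - A j k) * (p.groupMass k * δ j k) * p.predProb S j θ +
          etaA ^ 2 * (1 + Cd) ^ 2 := fun S => by
      refine (sq_clip_sub_le (hA j k)).trans ?_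
      have hh : (p.jointProb S j k θ - p.groupMass k * δ j k * p.predProb S j θ) ^ 2 ≤
          (1 + Cd) ^ 2 := by
        have hCd := hf.nonneg.2.2
        rw [sq_le_sq, abs_of_nonneg (by linarith : 0 ≤ 1 + Cd)]
        refine (abs_sub _ _).trans (add_le_add ?_ ?_)
        · rw [abs_of_nonneg (p.jointProb_nonneg S j k θ)]
          exact (p.jointProb_le_predProb S j k θ).trans (p.predProb_le_one S j θ)
        · rw [abs_mul, abs_mul, abs_of_nonneg (p.groupMass_nonneg k),
            abs_of_nonneg (p.predProb_nonneg S j θ)]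
          refine (mul_le_of_le_one_right (mul_nonneg (p.groupMass_nonneg k) (abs_nonneg _))
            (p.predProb_le_one S j θ)).trans ?_
          exact (mul_le_of_le_one_left (abs_nonneg _) (p.groupMass_le_one k)).trans
            (hf.abs_deriv_le _ (hz j k))
      have := mul_le_mul_of_nonneg_left hh (sq_nonneg etaA)
      simp only [δ] at this ⊢
      nlinarith
    refine (Finset.expect_le_expect fun S _ => hS S).trans ?_
    rw [Finset.expect_add_distrib, Finset.expect_sub_distrib, Finset.expect_add_distrib,
      ← Finset.mul_expect, ← Finset.mul_expect, expect_jointProb hB, expect_predProb hB,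
      Finset.expect_const Finset.univ_nonempty, Finset.expect_const Finset.univ_nonempty]
    -- Convexity of `f^*` turns the linear term of the ascent step into a difference of penalty
    -- values; the factor multiplying it is nonnegative.
    have hsg := hf.subgradient _ (hz j k) _ (hA j k)
    have h1 := mul_le_mul_of_nonneg_left hsg
      (mul_nonneg (mul_nonneg heta (p.groupMass_nonneg k)) (p.predProb_nonneg id j θ))
    simp only [δ]
    linarith
  calc _ = ∑ j, ∑ k, 𝔼 S : Fin B → Fin n,
        ((p.step f a₁ a₂ lam etaTheta etaA S (θ, A₁)).2 j k - A j k) ^ 2 := by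
        simp only [distSq, Finset.expect_sum_comm]
    _ ≤ _ := Finset.sum_le_sum fun j _ => Finset.sum_le_sum fun k _ => hterm j k
    _ = _ := by
        simp only [distSq, penalty, Finset.sum_add_distrib, Finset.sum_sub_distrib,
          ← Finset.mul_sum, Finset.sum_const, Finset.card_univ, Fintype.card_fin, nsmul_eq_mul]
        ring

theorem IsSmooth.norm_step_sub_le (hp : p.IsSmooth G β L b) (hlam : 0 ≤ lam)
    (hf : DualInterval f a₁ a₂ Ca Cs Cd) {etaTheta : ℝ} (heta : 0 ≤ etaTheta) (etaA : ℝ) {B : ℕ}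
    (S : Fin B → Fin n) {z : Param d × (Fin m → Fin q → ℝ)} (hz : InBox a₁ a₂ z.2) :
    ‖(p.step f a₁ a₂ lam etaTheta etaA S z).1 - z.1‖ ≤
      etaTheta * (G + lam * (m * q * ((Ca + Cs) * L))) := by
  rw [step, sub_sub_cancel_left, norm_neg, norm_smul, Real.norm_of_nonneg heta]
  exact mul_le_mul_of_nonneg_left (hp.norm_gradient_dualObjective_le hlam hf hz S _) heta

/-- The regret bound of online gradient ascent against a fixed comparator, the best dual variable at
`θ₀`: squared distances to it telescope, and the drift of `θ` away from `θ₀` is paid for separately.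
-/
theorem IsSmooth.sum_iterate_dualGap_le (hp : p.IsSmooth G β L b) (hn : 0 < n) (hlam : 0 ≤ lam)
    (hf : DualInterval f a₁ a₂ Ca Cs Cd) {B : ℕ} (hB : 1 ≤ B) {etaTheta etaA : ℝ}
    (hθ : 0 ≤ etaTheta) (hA : 0 < etaA) (θ₀ : Param d) (K : ℕ)
    {z : Param d × (Fin m → Fin q → ℝ)} (hz : InBox a₁ a₂ z.2) :
    ∑ k ∈ Finset.range K, (transition
        (fun S : Fin B → Fin n => p.step f a₁ a₂ lam etaTheta etaA S))^[k]
        (p.dualGap f a₁ a₂) z ≤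
      distSq z.2 (p.bestDual f a₁ a₂ θ₀) / (2 * etaA) + K * (etaA * (m * q * (1 + Cd) ^ 2) / 2) +
        ∑ k ∈ Finset.range K, 2 * (m * q * ((Ca + Cs) * L)) * (‖z.1 - θ₀‖ +
          k * (etaTheta * (G + lam * (m * q * ((Ca + Cs) * L))))) := by
  have : Nonempty (Fin n) := ⟨⟨0, hn⟩⟩
  have hC : 0 ≤ Ca + Cs := add_nonneg hf.nonneg.1 hf.nonneg.2.1
  have hbest := (bestDual_spec (p := p) hf θ₀).1
  -- The first step is peeled off and the bound is applied to the random state after it. This is why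
  -- `θ₀` is independent of the start `z`: the distance to `θ₀` grows by at most `etaTheta * Λ` per
  -- step.
  induction K generalizing z with
  | zero => simpa using div_nonneg (distSq_nonneg _ _) (by linarith)
  | succ K ih =>
    set Λ : ℝ := G + lam * (m * q * ((Ca + Cs) * L)) with hΛ
    set κ : ℝ := m * q * ((Ca + Cs) * L) with hκ
    have hκ0 : 0 ≤ κ := by positivity
    rw [Finset.sum_range_succ']
    simp only [Function.iterate_succ_apply', Function.iterate_zero, id]
    have hgap := hp.dualGap_le hf θ₀ z.1 z.2
    rw [← hκ] at hgap
    have hstep := expect_distSq_step_le (p := p) (lam := lam) hn hf hB etaTheta hA.le hz hbest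
    have hrest : ∑ k ∈ Finset.range K, transition
        (fun S : Fin B → Fin n => p.step f a₁ a₂ lam etaTheta etaA S) ((transition
        (fun S : Fin B → Fin n => p.step f a₁ a₂ lam etaTheta etaA S))^[k]
        (p.dualGap f a₁ a₂)) z ≤ 𝔼 S : Fin B → Fin n,
          (1 / (2 * etaA) * distSq (p.step f a₁ a₂ lam etaTheta etaA S z).2
            (p.bestDual f a₁ a₂ θ₀) + (K * (etaA * (m * q * (1 + Cd) ^ 2) / 2) +
        ∑ k ∈ Finset.range K, 2 * κ * (‖z.1 - θ₀‖ + ((k + 1 : ℕ) : ℝ) * (etaTheta * Λ)))) := by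
      simp only [transition]
      rw [← Finset.expect_sum_comm]
      refine Finset.expect_le_expect fun S _ => (ih (inBox_step hf.le _ _ S z)).trans ?_
      rw [add_assoc, one_div_mul_eq_div]
      refine add_le_add le_rfl (add_le_add le_rfl (Finset.sum_le_sum fun k _ => ?_))
      refine mul_le_mul_of_nonneg_left ?_ (by positivity)
      have h1 := hp.norm_step_sub_le hlam hf hθ etaA S hz
      have h2 := norm_sub_le_norm_sub_add_norm_sub
        (p.step f a₁ a₂ lam etaTheta etaA S z).1 z.1 θ₀
      push_cast
      linarith
    rw [Finset.expect_add_distrib, ← Finset.mul_expect,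
      Finset.expect_const Finset.univ_nonempty] at hrest
    rw [Finset.sum_range_succ']
    have h3 := mul_le_mul_of_nonneg_left hstep (by positivity : 0 ≤ 1 / (2 * etaA))
    have h4 : 1 / (2 * etaA) * (distSq z.2 (p.bestDual f a₁ a₂ θ₀) - 2 * etaA *
        (p.penalty id f (p.bestDual f a₁ a₂ θ₀) z.1 - p.penalty id f z.2 z.1) +
        etaA ^ 2 * (m * q * (1 + Cd) ^ 2)) = distSq z.2 (p.bestDual f a₁ a₂ θ₀) / (2 * etaA) -
        (p.penalty id f (p.bestDual f a₁ a₂ θ₀) z.1 - p.penalty id f z.2 z.1) +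
        etaA * (m * q * (1 + Cd) ^ 2) / 2 := by
      field_simp
    rw [h4] at h3
    push_cast at hrest ⊢
    linarith

theorem IsSmooth.sum_iterate_dualGap_le_block (hp : p.IsSmooth G β L b) (hn : 0 < n)
    (hlam : 0 ≤ lam) (hf : DualInterval f a₁ a₂ Ca Cs Cd) {B : ℕ} (hB : 1 ≤ B)
    {etaTheta etaA : ℝ} (hθ : 0 ≤ etaTheta) (hA : 0 < etaA) (K : ℕ)
    {z : Param d × (Fin m → Fin q → ℝ)} (hz : InBox a₁ a₂ z.2) :
    ∑ k ∈ Finset.range K, (transition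
        (fun S : Fin B → Fin n => p.step f a₁ a₂ lam etaTheta etaA S))^[k]
        (p.dualGap f a₁ a₂) z ≤
      m * q * (a₂ - a₁) ^ 2 / (2 * etaA) + K * (etaA * (m * q * (1 + Cd) ^ 2) / 2) +
        K ^ 2 * (2 * (m * q * ((Ca + Cs) * L)) *
          (etaTheta * (G + lam * (m * q * ((Ca + Cs) * L))))) := by
  have hC : 0 ≤ Ca + Cs := add_nonneg hf.nonneg.1 hf.nonneg.2.1
  refine (hp.sum_iterate_dualGap_le hn hlam hf hB hθ hA z.1 K hz).trans ?_
  refine add_le_add (add_le_add ?_ le_rfl) ?_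
  · exact div_le_div_of_nonneg_right (distSq_le hz (bestDual_spec hf _).1) (by linarith)
  · calc _ ≤ ∑ k ∈ Finset.range K, (K : ℝ) * (2 * (m * q * ((Ca + Cs) * L)) *
          (etaTheta * (G + lam * (m * q * ((Ca + Cs) * L))))) := by
          refine Finset.sum_le_sum fun k hk => ?_
          have hkK : (k : ℝ) ≤ K := by exact_mod_cast (Finset.mem_range.1 hk).le
          rw [sub_self, norm_zero, zero_add, mul_left_comm]
          exact mul_le_mul_of_nonneg_right hkK (by positivity)
      _ = _ := by rw [Finset.sum_const, Finset.card_range, nsmul_eq_mul]; ring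

/-! ### Descent of the Moreau envelope -/

/-- The proximal point `w` of the current iterate serves as a trial point for the envelope at the
next one. After averaging, the full gradient is paired with `w - z.1`. Taylor's bound, `Ψ ≥` the
min-max objective and minimality of `w` bound this pairing by `λ` times the dual gap minus `ρ / 2 *
‖w - z.1‖ ^ 2`, and the envelope has gradient `2ρ (z.1 - w)`. -/
theorem IsSmooth.moreauEnvelope_descent (hp : p.IsSmooth G β L b) (hn : 0 < n) (hlam : 0 ≤ lam)
    (hf : DualInterval f a₁ a₂ Ca Cs Cd) {B : ℕ} (hB : 1 ≤ B) {etaTheta : ℝ} (etaA : ℝ)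
    (hθ : 0 ≤ etaTheta) {ρ : ℝ} (hρ : 0 < ρ)
    (hρℓ : 2 * (β + lam * (m * q * ((Ca + Cs) * b))) ≤ ρ)
    {z : Param d × (Fin m → Fin q → ℝ)} (hz : InBox a₁ a₂ z.2) :
    𝔼 S : Fin B → Fin n, moreauEnvelope ρ (p.primal f a₁ a₂ lam)
        (p.step f a₁ a₂ lam etaTheta etaA S z).1 ≤
      moreauEnvelope ρ (p.primal f a₁ a₂ lam) z.1 +
        2 * ρ * etaTheta * lam * p.dualGap f a₁ a₂ z -
        etaTheta / 4 * ‖gradient (moreauEnvelope ρ (p.primal f a₁ a₂ lam)) z.1‖ ^ 2 +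
        ρ * etaTheta ^ 2 * (G + lam * (m * q * ((Ca + Cs) * L))) ^ 2 := by
  have : Nonempty (Fin n) := ⟨⟨0, hn⟩⟩
  have hC : 0 ≤ Ca + Cs := add_nonneg hf.nonneg.1 hf.nonneg.2.1
  have hΛ0 : 0 ≤ G + lam * (m * q * ((Ca + Cs) * L)) := by positivity
  have hℓ0 : 0 ≤ β + lam * (m * q * ((Ca + Cs) * b)) := by positivity
  have hlip := hp.primal_sub_le hlam hf
  have hpar := hp.hasLowerParaboloids_primal hlam hf
  obtain ⟨w, hw⟩ := exists_isProx hΛ0 hlip hρ z.1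
  have hgrad := (hw.hasGradientAt hΛ0 hlip hpar hρ (by linarith)).gradient
  have hnorm : ‖gradient (moreauEnvelope ρ (p.primal f a₁ a₂ lam)) z.1‖ ^ 2 =
      4 * ρ ^ 2 * ‖w - z.1‖ ^ 2 := by
    rw [hgrad, norm_smul, norm_sub_rev, Real.norm_of_nonneg (by positivity)]; ring
  have hS : ∀ S : Fin B → Fin n, moreauEnvelope ρ (p.primal f a₁ a₂ lam)
      (p.step f a₁ a₂ lam etaTheta etaA S z).1 ≤
      moreauEnvelope ρ (p.primal f a₁ a₂ lam) z.1 + 2 * ρ * etaTheta *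
        inner ℝ (w - z.1) (gradient (p.dualObjective S f lam z.2) z.1) +
        ρ * etaTheta ^ 2 * (G + lam * (m * q * ((Ca + Cs) * L))) ^ 2 := fun S => by
    set g := gradient (p.dualObjective S f lam z.2) z.1 with hg
    obtain ⟨w', hw'⟩ := exists_isProx hΛ0 hlip hρ (p.step f a₁ a₂ lam etaTheta etaA S z).1
    have h1 := hw'.moreauEnvelope_le w
    have h2 : ‖w - (p.step f a₁ a₂ lam etaTheta etaA S z).1‖ ^ 2 =
        ‖w - z.1‖ ^ 2 + 2 * etaTheta * inner ℝ (w - z.1) g + etaTheta ^ 2 * ‖g‖ ^ 2 := by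
      rw [step, ← hg, show w - (z.1 - etaTheta • g) = (w - z.1) + etaTheta • g by abel,
        norm_add_sq_real, real_inner_smul_right, norm_smul, mul_pow, Real.norm_eq_abs, sq_abs]
      ring
    have h3 := hp.norm_gradient_dualObjective_le hlam hf hz S z.1
    have h4 := mul_le_mul_of_nonneg_left (pow_le_pow_left₀ (norm_nonneg _) h3 2)
      (by positivity : 0 ≤ ρ * etaTheta ^ 2)
    rw [h2] at h1
    rw [hw.moreauEnvelope_eq]
    linarith
  refine (Finset.expect_le_expect fun S _ => hS S).trans ?_
  rw [Finset.expect_add_distrib, Finset.expect_add_distrib, ← Finset.mul_expect,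
    hp.expect_inner_gradient hB, Finset.expect_const Finset.univ_nonempty,
    Finset.expect_const Finset.univ_nonempty, hnorm]
  have h1 := (abs_le.1 (hp.abs_taylor_dualObjective_le hlam hf hz id z.1 w)).1
  have h2 := dualObjective_le_primal (p := p) hlam hf hz w
  have h3 := hw z.1
  simp only [sub_self, norm_zero] at h3
  have h4 : p.primal f a₁ a₂ lam z.1 - p.dualObjective id f lam z.2 z.1 =
      lam * p.dualGap f a₁ a₂ z := by
    rw [primal, dualObjective_eq_add, dualObjective_eq_add, dualGap]; ring
  rw [real_inner_comm] at h1
  have h5 := mul_le_mul_of_nonneg_right hρℓ (sq_nonneg ‖w - z.1‖)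
  have h6 : inner ℝ (w - z.1) (gradient (p.dualObjective id f lam z.2) z.1) ≤
      lam * p.dualGap f a₁ a₂ z - ρ / 2 * ‖w - z.1‖ ^ 2 := by
    linarith
  have h7 := mul_le_mul_of_nonneg_left h6 (by positivity : 0 ≤ 2 * ρ * etaTheta)
  linarith

/-- The sum of the expected squared gradient norms of the
Moreau envelope is controlled by the initial gap and the sum of the expected dual gaps. -/
theorem IsSmooth.sum_sq_gradient_le (hp : p.IsSmooth G β L b) (hn : 0 < n) (hlam : 0 ≤ lam)
    (hf : DualInterval f a₁ a₂ Ca Cs Cd) {B : ℕ} (hB : 1 ≤ B) {etaTheta : ℝ} (etaA : ℝ)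
    (hθ : 0 ≤ etaTheta) {ρ : ℝ} (hρ : 0 < ρ)
    (hρℓ : 2 * (β + lam * (m * q * ((Ca + Cs) * b))) ≤ ρ)
    {z : Param d × (Fin m → Fin q → ℝ)} (hz : InBox a₁ a₂ z.2) {D : ℝ}
    (hD : ∀ w, p.primal f a₁ a₂ lam z.1 - p.primal f a₁ a₂ lam w ≤ D) (N : ℕ) :
    etaTheta / 4 * ∑ t ∈ Finset.range N, (transition
        (fun S : Fin B → Fin n => p.step f a₁ a₂ lam etaTheta etaA S))^[t]
        (fun z => ‖gradient (moreauEnvelope ρ (p.primal f a₁ a₂ lam)) z.1‖ ^ 2) z ≤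
      D + 2 * ρ * etaTheta * lam * ∑ t ∈ Finset.range N, (transition
        (fun S : Fin B → Fin n => p.step f a₁ a₂ lam etaTheta etaA S))^[t]
        (p.dualGap f a₁ a₂) z +
        N * (ρ * etaTheta ^ 2 * (G + lam * (m * q * ((Ca + Cs) * L))) ^ 2) := by
  have : Nonempty (Fin n) := ⟨⟨0, hn⟩⟩
  have hC : 0 ≤ Ca + Cs := add_nonneg hf.nonneg.1 hf.nonneg.2.1
  have hΛ0 : 0 ≤ G + lam * (m * q * ((Ca + Cs) * L)) := by positivity
  have hlip := hp.primal_sub_le hlam hf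
  set Λ : ℝ := G + lam * (m * q * ((Ca + Cs) * L)) with hΛ
  set e : Param d × (Fin m → Fin q → ℝ) → ℝ :=
    fun z => moreauEnvelope ρ (p.primal f a₁ a₂ lam) z.1 with he
  set P := transition (fun S : Fin B → Fin n => p.step f a₁ a₂ lam etaTheta etaA S) with hP
  set g : Param d × (Fin m → Fin q → ℝ) → ℝ :=
    fun z => ‖gradient (moreauEnvelope ρ (p.primal f a₁ a₂ lam)) z.1‖ ^ 2 with hg
  have hgood : ∀ (S : Fin B → Fin n) (z : Param d × (Fin m → Fin q → ℝ)), InBox a₁ a₂ z.2 →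
      InBox a₁ a₂ (p.step f a₁ a₂ lam etaTheta etaA S z).2 :=
    fun S z _ => inBox_step hf.le _ _ S z
  have hone : ∀ t, P^[t + 1] e z + etaTheta / 4 * P^[t] g z ≤ P^[t] e z +
      2 * ρ * etaTheta * lam * P^[t] (p.dualGap f a₁ a₂) z + ρ * etaTheta ^ 2 * Λ ^ 2 := by
    intro t
    have h1 := iterate_transition_mono (g := fun z => P e z + etaTheta / 4 * g z)
      (h := fun z => (e z + 2 * ρ * etaTheta * lam * p.dualGap f a₁ a₂ z) +
        ρ * etaTheta ^ 2 * Λ ^ 2) (good := fun z => InBox a₁ a₂ z.2) hgood (fun z hz => by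
          have := hp.moreauEnvelope_descent hn hlam hf hB etaA hθ hρ hρℓ hz
          simp only [hP, transition, he, hg]
          linarith) t hz
    rw [iterate_transition_add, iterate_transition_add, iterate_transition_add,
      iterate_transition_const_mul, iterate_transition_const_mul, iterate_transition_const] at h1
    exact h1
  have hsum : ∀ N : ℕ, P^[N] e z + etaTheta / 4 * ∑ t ∈ Finset.range N, P^[t] g z ≤ e z +
      2 * ρ * etaTheta * lam * ∑ t ∈ Finset.range N, P^[t] (p.dualGap f a₁ a₂) z +
      N * (ρ * etaTheta ^ 2 * Λ ^ 2) := by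
    intro N
    induction N with
    | zero => simp
    | succ N ih =>
      rw [Finset.sum_range_succ, Finset.sum_range_succ]
      have := hone N
      push_cast
      linarith
  have hlow : p.primal f a₁ a₂ lam z.1 - D ≤ P^[N] e z := by
    have := iterate_transition_mono (g := fun _ => p.primal f a₁ a₂ lam z.1 - D) (h := e)
      (good := fun z => InBox a₁ a₂ z.2) hgood (fun z' _ => by
        obtain ⟨w, hw⟩ := exists_isProx hΛ0 hlip hρ z'.1
        simp only [he]
        rw [hw.moreauEnvelope_eq]
        have h2 : 0 ≤ ρ * ‖w - z'.1‖ ^ 2 := by positivity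
        linarith [hD w]) N hz
    rwa [iterate_transition_const] at this
  have hup : e z ≤ p.primal f a₁ a₂ lam z.1 := by
    obtain ⟨w, hw⟩ := exists_isProx hΛ0 hlip hρ z.1
    simpa using hw.moreauEnvelope_le z.1
  linarith [hsum N]

end Problem

end FFERM

/-! ### Transfer to the `f`-FERM objective and choice of parameters -/

namespace FFERM

namespace Problem

variable {X Y : Type*} {d m q n : ℕ} {p : Problem X Y d m q n}
  {f : ℝ → ℝ} {a₁ a₂ Ca Cs Cd lam : ℝ} {G β L b : ℝ≥0} {θ : Param d}

/-- Near a point at which the ratios are bounded below, the Moreau envelopes of the `f`-FERM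
objective and of the primal function agree. -/
theorem IsSmooth.moreauEnvelope_fermObjective_eventuallyEq (hp : p.IsSmooth G β L b) (hn : 0 < n)
    (hlam : 0 ≤ lam) (hf : DualInterval f a₁ a₂ Ca Cs Cd) {pi₀ τ μ r ρ : ℝ} (hpi₀ : 0 < pi₀)
    (hτ : 0 ≤ τ) (hr0 : 0 < r) (hr : τ = 0 ∨ L * r * (1 + τ / 2) ≤ τ * pi₀ * μ / 4) (hρ : 0 < ρ)
    (hρr : (G + lam * (m * q * ((Ca + Cs) * L))) / ρ ≤ r / 2)
    (hsub : ∀ t : ℝ, 0 < t → τ / 2 ≤ t → t ≤ 1 / pi₀ →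
      ∃ a ∈ Set.Icc a₁ a₂, IsSubgradient f t a)
    (hπ : ∀ k, pi₀ ≤ p.groupMass k) (hμ : ∀ j, μ / 2 ≤ p.predProb id j θ)
    (hθ : ∀ j k, τ ≤ p.jointProb id j k θ / (p.predProb id j θ * p.groupMass k)) :
    moreauEnvelope ρ (p.fermObjective f lam) =ᶠ[nhds θ]
      moreauEnvelope ρ (p.primal f a₁ a₂ lam) := by
  have hC : 0 ≤ Ca + Cs := add_nonneg hf.nonneg.1 hf.nonneg.2.1
  have hΛ0 : 0 ≤ G + lam * (m * q * ((Ca + Cs) * L)) := by positivity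
  have hlip := hp.primal_sub_le hlam hf
  -- Half of the radius `r` is spent on the neighbourhood, the other half on the displacement of the
  -- proximal point.
  filter_upwards [Metric.ball_mem_nhds θ (half_pos hr0)] with θ' hθ'
  rw [Metric.mem_ball, dist_eq_norm] at hθ'
  obtain ⟨w, hw⟩ := exists_isProx hΛ0 hlip hρ θ'
  have h1 := hw.norm_sub_le hΛ0 hlip hρ
  have h2 : ‖w - θ‖ ≤ r := by
    have := norm_sub_le_norm_sub_add_norm_sub w θ' θ
    linarith
  have heq := fermObjective_eq_primal hlam hn hpi₀ hπ hf hsub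
    fun j k => hp.half_le_ratio hn hpi₀ hτ hr h2 (hπ k) (hμ j) (hθ j k)
  have hferm : IsProx ρ (p.fermObjective f lam) θ' w :=
    hw.of_le (fun u => dualObjective_le_fermObjective hlam hn (fun k => hpi₀.trans_le (hπ k)) hf
      (bestDual_spec hf u).1 u) heq
  rw [hferm.moreauEnvelope_eq, hw.moreauEnvelope_eq, heq]

theorem IsSmooth.differentiableAt_moreauEnvelope_primal (hp : p.IsSmooth G β L b)
    (hlam : 0 ≤ lam) (hf : DualInterval f a₁ a₂ Ca Cs Cd) {ρ : ℝ} (hρ : 0 < ρ)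
    (hρℓ : 2 * (β + lam * (m * q * ((Ca + Cs) * b))) ≤ ρ) (θ : Param d) :
    DifferentiableAt ℝ (moreauEnvelope ρ (p.primal f a₁ a₂ lam)) θ ∧
      ‖gradient (moreauEnvelope ρ (p.primal f a₁ a₂ lam)) θ‖ ≤
        2 * (G + lam * (m * q * ((Ca + Cs) * L))) := by
  have hC : 0 ≤ Ca + Cs := add_nonneg hf.nonneg.1 hf.nonneg.2.1
  have hΛ0 : 0 ≤ G + lam * (m * q * ((Ca + Cs) * L)) := by positivity
  have hℓ0 : 0 ≤ β + lam * (m * q * ((Ca + Cs) * b)) := by positivity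
  have hlip := hp.primal_sub_le hlam hf
  obtain ⟨w, hw⟩ := exists_isProx hΛ0 hlip hρ θ
  have hgrad := hw.hasGradientAt hΛ0 hlip (hp.hasLowerParaboloids_primal hlam hf) hρ (by linarith)
  refine ⟨hgrad.differentiableAt, ?_⟩
  have h1 := hw.norm_sub_le hΛ0 hlip hρ
  rw [le_div_iff₀ hρ] at h1
  rw [hgrad.gradient, norm_smul, norm_sub_rev, Real.norm_of_nonneg (by positivity)]
  linarith

end Problem

/-- The choice of the step sizes and of the block length that balances all error terms. -/
theorem exists_step_sizes {ρ R κ Λ H D₂ D : ℝ} (hρ : 0 ≤ ρ) (hR : 0 ≤ R) (hκ : 0 ≤ κ)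
    (hΛ : 0 ≤ Λ) (hH : 0 ≤ H) (hD₂ : 0 ≤ D₂) (hD : 0 ≤ D) :
    ∃ c₁ c₂ C : ℝ, 0 < c₁ ∧ 0 < c₂ ∧ 0 < C ∧ ∀ e N : ℝ, 0 < e → e ≤ 1 → C ≤ N * e ^ 8 →
      ∃ K : ℕ, 0 < K ∧ ∀ S Γ : ℝ,
        Γ ≤ (N / K + 1) * (D₂ / (2 * (c₂ * e ^ 2)) + K * (c₂ * e ^ 2 * H / 2) +
          K ^ 2 * (2 * κ * (c₁ * e ^ 6 * Λ))) →
        c₁ * e ^ 6 / 4 * S ≤ D + c₁ * e ^ 6 / 4 * R * Γ + N * (ρ * (c₁ * e ^ 6) ^ 2 * Λ ^ 2) →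
        S ≤ N * e ^ 2 := by
  -- Five errors share the budget `N * e ^ 2` equally. `c₂` handles the variance of the dual steps,
  -- `k₀` the dual diameter, and `c₁` both the drift within a block and the primal noise; the
  -- initial gap is left to `C`. The summands `1` in `c₁` and `c₂` keep the denominators positive.
  set c₂ : ℝ := 1 / (5 * R * H + 1) with hc₂
  have hc₂0 : 0 < c₂ := by positivity
  set k₀ : ℝ := 5 * R * D₂ / c₂ + 1 with hk₀
  have hk₀1 : 1 ≤ k₀ := by
    have : 0 ≤ 5 * R * D₂ / c₂ := by positivity
    linarith
  have hk₀0 : 0 < k₀ := by linarith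
  set c₁ : ℝ := 1 / (40 * R * k₀ * κ * Λ + 20 * ρ * Λ ^ 2 + 1) with hc₁
  have hc₁0 : 0 < c₁ := by positivity
  have e1 : R * c₂ * H ≤ 1 / 5 := by
    have h : c₂ * (5 * R * H + 1) = 1 := by rw [hc₂]; field_simp
    linarith
  have e2 : R * D₂ / (k₀ * c₂) ≤ 1 / 5 := by
    rw [div_le_iff₀ (by positivity)]
    have h : k₀ * c₂ = 5 * R * D₂ + c₂ := by rw [hk₀]; field_simp
    rw [h]; linarith
  have hc₁e : c₁ * (40 * R * k₀ * κ * Λ + 20 * ρ * Λ ^ 2 + 1) = 1 := by rw [hc₁]; field_simp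
  have hn1 : 0 ≤ c₁ * (40 * R * k₀ * κ * Λ) := by positivity
  have hn2 : 0 ≤ c₁ * (20 * ρ * Λ ^ 2) := by positivity
  have e3 : R * (8 * k₀ * κ * Λ * c₁) ≤ 1 / 5 := by linarith
  have e4 : 4 * ρ * Λ ^ 2 * c₁ ≤ 1 / 5 := by linarith
  clear_value c₁ k₀ c₂
  -- The first summand makes the initial gap small, the second ensures that a block is no longer
  -- than the horizon, `K ≤ N`.
  refine ⟨c₁, c₂, 20 * D / c₁ + 2 * k₀, hc₁0, hc₂0, by positivity, fun e N he he1 hN => ?_⟩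
  have he4 : e ^ 4 ≤ 1 := pow_le_one₀ he.le he1
  -- This length balances the diameter term, of order `1 / (K * e ^ 2)`, with the drift term, of
  -- order `K * e ^ 6`. As `k₀ ≥ 1`, rounding up at most doubles it.
  set K : ℕ := ⌈k₀ / e ^ 4⌉₊ with hK
  have hKlow : k₀ / e ^ 4 ≤ K := Nat.le_ceil _
  have hk₀e : 1 ≤ k₀ / e ^ 4 := by
    rw [le_div_iff₀ (by positivity)]; linarith
  have hKup : (K : ℝ) ≤ 2 * k₀ / e ^ 4 := by
    have := (Nat.ceil_lt_add_one (by positivity : 0 ≤ k₀ / e ^ 4)).le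
    rw [mul_div_assoc]; linarith
  have hK0 : (0 : ℝ) < K := by linarith
  have hD0 : 0 ≤ 20 * D / c₁ := by positivity
  have hN0 : 0 < N := pos_of_mul_pos_left (by linarith : 0 < N * e ^ 8) (by positivity)
  have hKN : (K : ℝ) ≤ N := by
    refine hKup.trans ?_
    rw [div_le_iff₀ (by positivity)]
    have : e ^ 8 ≤ e ^ 4 := pow_le_pow_of_le_one he.le he1 (by norm_num)
    have := mul_le_mul_of_nonneg_left this hN0.le
    linarith
  refine ⟨K, by exact_mod_cast hK0, fun S Γ hΓ hS => ?_⟩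
  have hΓ' : Γ ≤ N * (D₂ / (K * (c₂ * e ^ 2)) + c₂ * e ^ 2 * H +
      4 * K * κ * Λ * (c₁ * e ^ 6)) := by
    refine hΓ.trans ?_
    have h1 : N / K + 1 ≤ 2 * N / K := by
      rw [mul_div_assoc, two_mul]
      have : 1 ≤ N / K := by rw [le_div_iff₀ hK0]; linarith
      linarith
    refine (mul_le_mul_of_nonneg_right h1 (by positivity)).trans_eq ?_
    field_simp
    ring
  have t1 : D₂ / (K * (c₂ * e ^ 2)) ≤ D₂ / (k₀ * c₂) * e ^ 2 := by
    rw [div_mul_eq_mul_div, div_le_div_iff₀ (by positivity) (by positivity)]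
    have h : k₀ ≤ K * e ^ 4 := by rwa [div_le_iff₀ (by positivity)] at hKlow
    have := mul_le_mul_of_nonneg_left h (by positivity : 0 ≤ D₂ * c₂)
    linarith
  have t2 : 4 * K * κ * Λ * (c₁ * e ^ 6) ≤ 8 * k₀ * κ * Λ * c₁ * e ^ 2 := by
    have h : K * e ^ 4 ≤ 2 * k₀ := by rwa [le_div_iff₀ (by positivity)] at hKup
    have := mul_le_mul_of_nonneg_left h (by positivity : 0 ≤ 4 * κ * Λ * c₁ * e ^ 2)
    linarith
  have hRΓ : R * Γ ≤ N * (3 / 5 * e ^ 2) := by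
    have h1 : Γ ≤ N * (D₂ / (k₀ * c₂) * e ^ 2 + c₂ * e ^ 2 * H +
        8 * k₀ * κ * Λ * c₁ * e ^ 2) := hΓ'.trans (by gcongr)
    refine (mul_le_mul_of_nonneg_left h1 hR).trans ?_
    rw [mul_left_comm]
    refine mul_le_mul_of_nonneg_left ?_ hN0.le
    have h2 : R * (D₂ / (k₀ * c₂) * e ^ 2 + c₂ * e ^ 2 * H + 8 * k₀ * κ * Λ * c₁ * e ^ 2) =
        (R * D₂ / (k₀ * c₂) + R * c₂ * H + R * (8 * k₀ * κ * Λ * c₁)) * e ^ 2 := by ring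
    rw [h2]
    exact mul_le_mul_of_nonneg_right (by linarith) (by positivity)
  have t3 : 4 * (ρ * (c₁ * e ^ 6) * Λ ^ 2) ≤ 1 / 5 * e ^ 2 := by
    have h1 : e ^ 6 ≤ e ^ 2 := pow_le_pow_of_le_one he.le he1 (by norm_num)
    calc _ = 4 * ρ * Λ ^ 2 * c₁ * e ^ 6 := by ring
      _ ≤ 1 / 5 * e ^ 2 := mul_le_mul e4 h1 (by positivity) (by norm_num)
  have t4 : 4 * D ≤ c₁ * e ^ 6 * (N * (1 / 5 * e ^ 2)) := by
    have h1 : 20 * D / c₁ ≤ N * e ^ 8 := by linarith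
    rw [div_le_iff₀ hc₁0] at h1
    linarith
  have hη : 0 < c₁ * e ^ 6 := by positivity
  refine le_of_mul_le_mul_left ?_ hη
  have h1 := mul_le_mul_of_nonneg_left hRΓ hη.le
  have h2 := mul_le_mul_of_nonneg_left t3 (by positivity : 0 ≤ c₁ * e ^ 6 * N)
  linarith

/-- If the time horizon is of order `ε⁻⁸` and `ε` is bounded, then it is also of order
`(min ε 1)⁻⁸`. -/
theorem le_mul_min_pow {C R ε T : ℝ} (hC : 0 ≤ C) (hR : 1 ≤ R) (hε : 0 < ε) (hεR : ε ≤ R)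
    (hT : C * R ^ 8 / ε ^ 8 ≤ T) : C ≤ T * (min ε 1) ^ 8 := by
  have hmin : 0 < min ε 1 := lt_min hε one_pos
  have h1 : ε ≤ R * min ε 1 := by
    rcases le_total ε 1 with h | h
    · rw [min_eq_left h]; nlinarith
    · rw [min_eq_right h]; linarith
  have h2 : ε ^ 8 ≤ R ^ 8 * (min ε 1) ^ 8 := by
    rw [← mul_pow]; exact pow_le_pow_left₀ hε.le h1 8
  have hR8 : 0 < R ^ 8 := by positivity
  have hT0 : 0 ≤ T := (by positivity : 0 ≤ C * R ^ 8 / ε ^ 8).trans hT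
  rw [div_le_iff₀ (by positivity)] at hT
  have h3 := hT.trans (mul_le_mul_of_nonneg_left h2 hT0)
  refine le_of_mul_le_mul_right ?_ hR8
  linarith

theorem exists_radius (L : ℝ≥0) {pi₀ μ τ : ℝ} (hpi₀ : 0 < pi₀) (hμ : 0 < μ) (hτ : 0 ≤ τ) :
    ∃ r : ℝ, 0 < r ∧ (τ = 0 ∨ L * r * (1 + τ / 2) ≤ τ * pi₀ * μ / 4) := by
  rcases hτ.eq_or_lt with h | h
  · exact ⟨1, one_pos, Or.inl h.symm⟩
  · have hL : 0 ≤ (L : ℝ) * (1 + τ / 2) := by positivity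
    refine ⟨τ * pi₀ * μ / 4 / (L * (1 + τ / 2) + 1), by positivity, Or.inr ?_⟩
    have h0 : 0 < τ * pi₀ * μ / 4 := by positivity
    rw [mul_right_comm, mul_div_assoc', div_le_iff₀ (by linarith)]
    linarith

end FFERM

/-! ### The convergence theorem -/

theorem theorem2p2
    -- the number of classes and of groups, the divergence and the dual interval
    (m q : ℕ) (f : ℝ → ℝ) (hf : ConvexOn ℝ (Set.Ioi 0) f)
    (a₁ a₂ : ℝ) (ha : a₁ ≤ a₂)
    -- the conjugate is finite and smooth on the dual interval
    (hdom : ∀ a ∈ Set.Icc a₁ a₂, FFERM.InConjDomain f a)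
    (hdiff : DifferentiableOn ℝ (FFERM.conj f) (Set.Icc a₁ a₂))
    (M : ℝ≥0)
    (hsmooth : LipschitzOnWith M (derivWithin (FFERM.conj f) (Set.Icc a₁ a₂)) (Set.Icc a₁ a₂))
    -- the constants of the problem
    (lam : ℝ) (hlam : 0 ≤ lam) (G β L b : ℝ≥0)
    (pi₀ : ℝ) (hpi₀ : 0 < pi₀) (μ : ℝ) (hμ : 0 < μ) (τ : ℝ) (hτ : 0 ≤ τ) (Δ : ℝ)
    -- the dual interval has a subgradient of `f` at all ratios in question
    (hsub : ∀ t : ℝ, 0 < t → τ / 2 ≤ t → t ≤ 1 / pi₀ →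
      ∃ a ∈ Set.Icc a₁ a₂, FFERM.IsSubgradient f t a) :
    ∃ ρ₀ : ℝ, 0 < ρ₀ ∧ ∀ ρ : ℝ, ρ₀ ≤ ρ →
    ∃ c₁ c₂ C : ℝ, 0 < c₁ ∧ 0 < c₂ ∧ 0 < C ∧
    ∀ (X Y : Type*) (d n : ℕ) (p : FFERM.Problem X Y d m q n)
      (θ₀ : FFERM.Param d) (A₀ : Fin m → Fin q → ℝ),
      (∀ i, FFERM.LipschitzSmooth G β fun θ => p.loss θ (p.x i) (p.y i)) →
      (∀ j i, FFERM.LipschitzSmooth L b (p.F j i)) →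
      (∀ k, pi₀ ≤ p.groupMass k) →
      (∀ θ, p.avgLoss id θ₀ - p.avgLoss id θ ≤ Δ) →
      (∀ j k, A₀ j k ∈ Set.Icc a₁ a₂) →
    ∀ B : ℕ, 1 ≤ B → B ≤ n →
    ∀ ε : ℝ, 0 < ε → ∀ T : ℕ, C / ε ^ 8 ≤ T →
    ∀ θ : (t : ℕ) → (Fin t → Fin B → Fin n) → FFERM.Param d,
      -- `θ t ω` is the `t`-th iterate along the minibatches `ω`
      (θ = fun t ω => (p.sgda f a₁ a₂ lam (c₁ * (min ε 1) ^ 6) (c₂ * (min ε 1) ^ 2)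
        (θ₀, A₀) t ω).1) →
      -- along the iterates the predicted-class probabilities, and their ratios between a
      -- group and the population, are bounded from below
      (∀ t ≤ T, ∀ ω, ∀ j, μ / 2 ≤ p.predProb id j (θ t ω)) →
      (∀ t ≤ T, ∀ ω, ∀ j k, τ ≤ p.jointProb id j k (θ t ω) /
        (p.predProb id j (θ t ω) * p.groupMass k)) →
      (∀ t ≤ T, ∀ ω, DifferentiableAt ℝ
        (FFERM.moreauEnvelope ρ (p.fermObjective f lam)) (θ t ω)) ∧
      𝔼 t ∈ Finset.range (T + 1), 𝔼 ω : Fin t → Fin B → Fin n,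
        ‖gradient (FFERM.moreauEnvelope ρ (p.fermObjective f lam)) (θ t ω)‖ ≤ ε := by
  obtain ⟨Ca, Cs, Cd, hI⟩ := FFERM.exists_dualInterval ha hdom hdiff hsmooth
  have hC : 0 ≤ Ca + Cs := add_nonneg hI.nonneg.1 hI.nonneg.2.1
  have hCd := hI.nonneg.2.2
  obtain ⟨r, hr0, hr⟩ := FFERM.exists_radius L hpi₀ hμ hτ
  set κ : ℝ := m * q * ((Ca + Cs) * L) with hκ
  have hκ0 : 0 ≤ κ := by positivity
  set Λ : ℝ := G + lam * κ with hΛ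
  have hΛ0 : 0 ≤ Λ := by positivity
  set ℓ : ℝ := β + lam * (m * q * ((Ca + Cs) * b)) with hℓ
  have hℓ0 : 0 ≤ ℓ := by positivity
  -- The first summand dominates the weak convexity, the second keeps proximal points within `r / 2`
  -- of their centres, and the third ensures positivity.
  refine ⟨2 * ℓ + 2 * Λ / r + 1, by positivity, fun ρ hρ₀ => ?_⟩
  have hquot : 0 ≤ 2 * Λ / r := by positivity
  have hρ : 0 < ρ := by linarith
  have hρℓ : 2 * ℓ ≤ ρ := by linarith
  have hρr : Λ / ρ ≤ r / 2 := by
    have h : 2 * Λ / r ≤ ρ := by linarith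
    rw [div_le_iff₀ hr0] at h
    rw [div_le_iff₀ hρ]
    linarith
  -- A bound on the initial gap of the primal function: the penalty is bounded, so its oscillation
  -- adds only a constant to that of the loss. The absolute value provides nonnegativity before any
  -- data are given.
  have hD : 0 ≤ |Δ| + lam * (2 * (m * q * (Ca + Cs))) := by positivity
  obtain ⟨c₁, c₂, C, hc₁, hc₂, hCpos, hsizes⟩ := FFERM.exists_step_sizes (ρ := ρ)
    (R := 8 * ρ * lam) (κ := κ) (Λ := Λ) (H := m * q * (1 + Cd) ^ 2)
    (D₂ := m * q * (a₂ - a₁) ^ 2) hρ.le (by positivity) hκ0 hΛ0 (by positivity) (by positivity) hD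
  -- The step sizes depend on `min ε 1`, the horizon on `ε`. The extra factor makes up for the
  -- difference as long as `ε < 2 * Λ`.
  refine ⟨c₁, c₂, C * (max 1 (2 * Λ)) ^ 8, hc₁, hc₂, by positivity, ?_⟩
  intro X Y d n p θ₀ A₀ hloss hF hπ hΔ hA₀ B hB hBn ε hε T hT θ hθ hpred hratio
  have hn : 0 < n := by omega
  have hne : Nonempty (Fin n) := ⟨⟨0, hn⟩⟩
  have hp : p.IsSmooth G β L b := ⟨hloss, hF⟩
  set e : ℝ := min ε 1 with he
  have he0 : 0 < e := lt_min hε one_pos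
  have hηθ : 0 < c₁ * e ^ 6 := by positivity
  have hηA : 0 < c₂ * e ^ 2 := by positivity
  set Ψ := FFERM.moreauEnvelope ρ (p.primal f a₁ a₂ lam) with hΨ
  have heq : ∀ t ≤ T, ∀ ω, FFERM.moreauEnvelope ρ (p.fermObjective f lam) =ᶠ[nhds (θ t ω)] Ψ :=
    fun t ht ω => hp.moreauEnvelope_fermObjective_eventuallyEq hn hlam hI hpi₀ hτ hr0 hr hρ hρr
      hsub hπ (hpred t ht ω) (hratio t ht ω)
  have hdiffΨ := fun v => hp.differentiableAt_moreauEnvelope_primal hlam hI hρ hρℓ v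
  refine ⟨fun t ht ω => (heq t ht ω).differentiableAt_iff.2 (hdiffΨ _).1, ?_⟩
  have hgrad : ∀ t ∈ Finset.range (T + 1), 𝔼 ω : Fin t → Fin B → Fin n,
      ‖gradient (FFERM.moreauEnvelope ρ (p.fermObjective f lam)) (θ t ω)‖ =
      𝔼 ω : Fin t → Fin B → Fin n, ‖gradient Ψ (θ t ω)‖ := fun t ht =>
    Finset.expect_congr rfl fun ω _ => by
      rw [(heq t (Nat.lt_succ_iff.1 (Finset.mem_range.1 ht)) ω).gradient_eq]
  rw [Finset.expect_congr rfl hgrad]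
  -- The envelope gradient never exceeds `2 * Λ` in norm, so large `ε` needs no iteration at all.
  rcases le_or_gt (2 * Λ) ε with hbig | hsmall
  · exact Finset.expect_le ⟨0, by simp⟩ fun t _ => Finset.expect_le Finset.univ_nonempty
      fun ω _ => (hdiffΨ _).2.trans hbig
  have hCN : C ≤ ((T + 1 : ℕ) : ℝ) * e ^ 8 := by
    have h1 := FFERM.le_mul_min_pow hCpos.le (le_max_left 1 (2 * Λ)) hε
      (hsmall.le.trans (le_max_right _ _)) hT
    have h2 : (0 : ℝ) ≤ e ^ 8 := by positivity
    push_cast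
    linarith
  obtain ⟨K, hK, hsize⟩ := hsizes e ((T + 1 : ℕ) : ℝ) he0 (min_le_right _ _) hCN
  have hgap := FFERM.sum_iterate_transition_le (good := fun z => FFERM.Problem.InBox a₁ a₂ z.2)
    (fun S z _ => FFERM.Problem.inBox_step ha _ _ S z)
    (fun z hz => FFERM.Problem.dualGap_nonneg hI hz) hK
    (fun z hz => hp.sum_iterate_dualGap_le_block hn hlam hI hB hηθ.le hηA K hz) (T + 1)
    (z := (θ₀, A₀)) hA₀
  have hsum := hp.sum_sq_gradient_le hn hlam hI hB (c₂ * e ^ 2) hηθ.le hρ hρℓ (z := (θ₀, A₀)) hA₀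
    (fun w => FFERM.Problem.primal_sub_le_of_avgLoss hlam hI ((hΔ w).trans (le_abs_self Δ)))
    (T + 1)
  rw [← hκ, ← hΛ] at hgap hsum
  have hS := hsize _ _ hgap (hsum.trans_eq (by ring))
  have horbit : ∀ t, 𝔼 ω : Fin t → Fin B → Fin n, ‖gradient Ψ (θ t ω)‖ ^ 2 =
      (FFERM.transition (fun S : Fin B → Fin n =>
        p.step f a₁ a₂ lam (c₁ * e ^ 6) (c₂ * e ^ 2) S))^[t]
        (fun z => ‖gradient Ψ z.1‖ ^ 2) (θ₀, A₀) := fun t => by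
    rw [← FFERM.expect_eq_iterate_transition _ _
      (p.sgda f a₁ a₂ lam (c₁ * e ^ 6) (c₂ * e ^ 2) (θ₀, A₀)) (fun _ => rfl) (fun _ _ => rfl), hθ]
  -- The elementary inequality `x ≤ x² / (2ε) + ε / 2` takes the place of Jensen's: a mean square of
  -- at most `ε²` gives a mean of at most `ε`.
  have hjensen : ∀ t, 𝔼 ω : Fin t → Fin B → Fin n, ‖gradient Ψ (θ t ω)‖ ≤
      1 / (2 * ε) * 𝔼 ω : Fin t → Fin B → Fin n, ‖gradient Ψ (θ t ω)‖ ^ 2 + ε / 2 := fun t => by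
    have hconst : 𝔼 _ω : Fin t → Fin B → Fin n, ε / 2 = ε / 2 :=
      Finset.expect_const Finset.univ_nonempty _
    rw [← hconst, Finset.mul_expect, ← Finset.expect_add_distrib]
    refine Finset.expect_le_expect fun ω _ => ?_
    have h : 1 / (2 * ε) * ‖gradient Ψ (θ t ω)‖ ^ 2 + ε / 2 - ‖gradient Ψ (θ t ω)‖ =
        (‖gradient Ψ (θ t ω)‖ - ε) ^ 2 / (2 * ε) := by field_simp; ring
    have h0 : 0 ≤ (‖gradient Ψ (θ t ω)‖ - ε) ^ 2 / (2 * ε) := by positivity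
    linarith
  refine (Finset.expect_le_expect fun t _ => hjensen t).trans ?_
  rw [Finset.expect_eq_sum_div_card, Finset.sum_add_distrib, ← Finset.mul_sum,
    Finset.sum_congr rfl fun t _ => horbit t, Finset.sum_const, Finset.card_range, nsmul_eq_mul,
    div_le_iff₀ (by positivity)]
  have hN0 : (0 : ℝ) ≤ ((T + 1 : ℕ) : ℝ) := by positivity
  have hee : e ^ 2 ≤ ε ^ 2 := pow_le_pow_left₀ he0.le (min_le_left _ _) 2
  have h1 := mul_le_mul_of_nonneg_left (hS.trans (mul_le_mul_of_nonneg_left hee hN0))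
    (by positivity : 0 ≤ 1 / (2 * ε))
  have h2 : 1 / (2 * ε) * (((T + 1 : ℕ) : ℝ) * ε ^ 2) = ((T + 1 : ℕ) : ℝ) * (ε / 2) := by
    field_simp
  rw [h2] at h1
  linarith
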